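/- **Theorem 1.** For a group $G$ with a finite generating set $S$, let $F_{G,S}(n)$ be the number of elements of $G$ that are products of at most $n$ elements of $S\cup S^{-1}$, let $\omega(G,S)=\lim_{n\to\infty}F_{G,S}(n)^{1/n}$ be the exponential growth rate of $G$ with respect to $S$, and let $\Omega(G)=\inf_S\omega(G,S)$, the infimum over all finite generating sets $S$ of $G$, be the minimal exponential growth rate of $G$. For $n\ge 2$ let $$BS(1,n)=\langle a,t\mid tat^{-1}=a^n\rangle$$ be the Baumslag–Solitar group, and let $\mathcal L_n=(\mathbb Z/n\mathbb Z)\wr\mathbb Z=\bigl(\bigoplus_{\mathbb Z}\mathbb Z/n\mathbb Z\bigr)\rtimes\mathbb Z$ be the lamplighter group (the restricted wreath product), with canonical generators $a$, the generator of the copy of $\mathbb Z/n\mathbb Z$ at position $0$, and $t$, the generator of $\mathbb Z$. Let $p$ be a prime. Then $\Omega(\mathcal L_p)=\omega(\mathcal L_p,\{a,t\})$ and $\Omega(BS(1,p))=\omega(BS(1,p),\{a,t\})$; that is, both minimal growth rates are attained on the canonical generators. Moreover: 1. If $p=2k+1$ is odd, then $$\Omega(\mathcal L_p)=\Omega(BS(1,p))=\omega_k,$$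 where $\omega_k$ is the unique positive root of $x^{k+1}-x^k-2x^{k-1}-\dots-2x-2$. 2. If $p=2$, then $$\Omega(\mathcal L_2)=\frac{1+\sqrt5}{2}<\Omega(BS(1,2))=\beta,$$ where $\beta\approx 1.69562$ is the unique positive root of $z^3-z^2-2$. -/

import Mathlib

open Filter Topology Polynomial

namespace GroupGrowth

variable {G : Type*} [Group G]

/-- The word length `ℓ_{G,S}(g)`: the minimal length of a product of elements of `S ∪ S⁻¹` equal
to `g` (it is `⊤` exactly if there is no such product). -/
noncomputable def wordLength (S : Set G) (g : G) : ℕ∞ :=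
  ⨅ l ∈ {l : List G | (∀ s ∈ l, s ∈ S ∨ s⁻¹ ∈ S) ∧ l.prod = g}, (l.length : ℕ∞)

/-- The ball of radius `n` around the identity. -/
def ball (S : Set G) (n : ℕ) : Set G := {g | wordLength S g ≤ n}

/-- The growth function `F_{G,S}`. -/
noncomputable def growthFunction (S : Set G) (n : ℕ) : ℕ := (ball S n).ncard

/-- The exponential growth rate `ω(G, S) = lim F_{G,S}(n)^{1/n}`. -/
noncomputable def growthRate (S : Set G) : ℝ :=
  limUnder atTop fun n : ℕ ↦ (growthFunction S n : ℝ) ^ (1 / (n : ℝ))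

/-- `S` is a finite generating set of the group. -/
def IsFiniteGeneratingSet (S : Set G) : Prop := S.Finite ∧ Subgroup.closure S = ⊤

variable (G) in
/-- The minimal exponential growth rate `Ω(G)`: the infimum of `ω(G, S)` over all finite
generating sets `S`. -/
noncomputable def minimalGrowthRate : ℝ :=
  sInf {w : ℝ | ∃ S : Set G, IsFiniteGeneratingSet S ∧ growthRate S = w}

/-- The minimal growth rate of the group is realized on the finite generating set `S`. -/
def RealizesMinimalGrowthRate (S : Set G) : Prop :=
  IsFiniteGeneratingSet S ∧ growthRate S = minimalGrowthRate G

/-! The limit that defines `growthRate` exists and is at least `1` for every finite set, so the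
infimum that defines `minimalGrowthRate` is one over a set that is bounded below. -/

theorem mem_ball_iff {S : Set G} {n : ℕ} {g : G} :
    g ∈ ball S n ↔ ∃ l : List G, (∀ s ∈ l, s ∈ S ∨ s⁻¹ ∈ S) ∧ l.prod = g ∧ l.length ≤ n := by
  constructor
  · intro h
    by_contra! hc
    have : ((n + 1 : ℕ) : ℕ∞) ≤ wordLength S g := by
      refine le_iInf₂ fun l hl ↦ ?_
      exact_mod_cast hc l hl.1 hl.2
    have h2 := this.trans h
    have h3 : n + 1 ≤ n := by exact_mod_cast h2
    omega
  · rintro ⟨l, h1, h2, h3⟩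
    have h4 : wordLength S g ≤ l.length := iInf₂_le_of_le l ⟨h1, h2⟩ le_rfl
    exact h4.trans (by exact_mod_cast h3)

theorem ball_finite {S : Set G} (hS : S.Finite) (n : ℕ) : (ball S n).Finite := by
  have hT : {s : G | s ∈ S ∨ s⁻¹ ∈ S}.Finite := hS.union (hS.preimage inv_injective.injOn)
  have := Set.finite_coe_iff.mpr hT
  refine ((List.finite_length_le {s : G | s ∈ S ∨ s⁻¹ ∈ S} n).image
    fun l ↦ (l.map Subtype.val).prod).subset ?_
  intro g hg
  obtain ⟨l, h1, h2, h3⟩ := mem_ball_iff.mp hg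
  refine ⟨l.attach.map fun x ↦ ⟨x.1, h1 x.1 x.2⟩, by simpa using h3, ?_⟩
  simpa [List.map_map, Function.comp_def] using h2

theorem one_le_growthFunction {S : Set G} (hS : S.Finite) (n : ℕ) : 1 ≤ growthFunction S n :=
  (Set.ncard_pos (ball_finite hS n)).mpr ⟨1, mem_ball_iff.mpr ⟨[], by simp⟩⟩

theorem growthFunction_add_le {S : Set G} (hS : S.Finite) (m n : ℕ) :
    growthFunction S (m + n) ≤ growthFunction S m * growthFunction S n := by
  unfold growthFunction
  rw [← Set.ncard_prod]
  refine le_trans (Set.ncard_le_ncard ?_ (((ball_finite hS m).prod (ball_finite hS n)).image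
    fun x : G × G ↦ x.1 * x.2)) (Set.ncard_image_le ((ball_finite hS m).prod (ball_finite hS n)))
  intro g hg
  obtain ⟨l, h1, h2, h3⟩ := mem_ball_iff.mp hg
  refine ⟨((l.take m).prod, (l.drop m).prod), ⟨?_, ?_⟩, ?_⟩
  · exact mem_ball_iff.mpr ⟨_, fun s hs ↦ h1 s (List.mem_of_mem_take hs), rfl, by simp⟩
  · exact mem_ball_iff.mpr ⟨_, fun s hs ↦ h1 s (List.mem_of_mem_drop hs), rfl, by simp; omega⟩
  · simp [← h2, List.prod_take_mul_prod_drop]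

theorem tendsto_growthRate {S : Set G} (hS : S.Finite) :
    Tendsto (fun n : ℕ ↦ (growthFunction S n : ℝ) ^ (1 / (n : ℝ))) atTop (𝓝 (growthRate S)) := by
  refine tendsto_nhds_limUnder ?_
  have hpos : ∀ n, (0 : ℝ) < growthFunction S n := fun n ↦ by
    exact_mod_cast one_le_growthFunction hS n
  have hsub : Subadditive fun n ↦ Real.log (growthFunction S n) := fun m n ↦ by
    rw [← Real.log_mul (hpos m).ne' (hpos n).ne']
    exact Real.log_le_log (hpos _) (by exact_mod_cast growthFunction_add_le hS m n)
  have hbdd : BddBelow (Set.range fun n : ℕ ↦ Real.log (growthFunction S n) / n) := by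
    refine ⟨0, ?_⟩
    rintro _ ⟨n, rfl⟩
    exact div_nonneg (Real.log_natCast_nonneg _) n.cast_nonneg
  refine ⟨Real.exp hsub.lim, ?_⟩
  refine ((Real.continuous_exp.tendsto _).comp (hsub.tendsto_lim hbdd)).congr fun n ↦ ?_
  simp [Real.rpow_def_of_pos (hpos n), div_eq_mul_inv]

theorem one_le_growthRate {S : Set G} (hS : S.Finite) : 1 ≤ growthRate S :=
  ge_of_tendsto' (tendsto_growthRate hS) fun n ↦
    Real.one_le_rpow (by exact_mod_cast one_le_growthFunction hS n) (by positivity)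

end GroupGrowth

/-- The shift action of `ℤ` on `⨁_ℤ ℤ/nℤ`: `m` sends the configuration `f` to
`i ↦ f (i - m)`. -/
noncomputable def lampShift (n : ℕ) : Multiplicative ℤ →* MulAut (Multiplicative (ℤ →₀ ZMod n)) where
  toFun m := AddEquiv.toMultiplicative (Finsupp.domCongr (Equiv.addRight m.toAdd))
  map_one' := by
    refine MulEquiv.ext fun f ↦ Multiplicative.toAdd.injective (Finsupp.ext fun i ↦ ?_)
    change f.toAdd (i + -0) = f.toAdd i
    simp
  map_mul' a b := by
    refine MulEquiv.ext fun f ↦ Multiplicative.toAdd.injective (Finsupp.ext fun i ↦ ?_)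
    change f.toAdd (i + -(a.toAdd + b.toAdd)) = f.toAdd (i + -a.toAdd + -b.toAdd)
    congr 1
    ring

/-- The lamplighter group `ℒ_n = (ℤ/nℤ) ≀ ℤ`, i.e. the restricted wreath product
`(⨁_ℤ ℤ/nℤ) ⋊ ℤ`. -/
abbrev Lamplighter (n : ℕ) : Type :=
  Multiplicative (ℤ →₀ ZMod n) ⋊[lampShift n] Multiplicative ℤ

namespace Lamplighter

/-- The generator `a`: the configuration with value `1` at the origin and `0` elsewhere. -/
noncomputable def a (n : ℕ) : Lamplighter n :=
  SemidirectProduct.inl (Multiplicative.ofAdd (Finsupp.single 0 1))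

/-- The generator `t` of the factor `ℤ`. -/
noncomputable def t (n : ℕ) : Lamplighter n := SemidirectProduct.inr (Multiplicative.ofAdd 1)

end Lamplighter

/-- The relators of `⟨a, t | t a t⁻¹ = a ^ n⟩`, where `a` is the letter `0` and `t` the letter
`1`. -/
def bsRelators (n : ℕ) : Set (FreeGroup (Fin 2)) :=
  {FreeGroup.of 1 * FreeGroup.of 0 * (FreeGroup.of 1)⁻¹ * (FreeGroup.of 0 ^ n)⁻¹}

/-- The Baumslag-Solitar group `BS(1, n) = ⟨a, t | t a t⁻¹ = a ^ n⟩`. -/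
abbrev BS (n : ℕ) : Type := PresentedGroup (bsRelators n)

namespace BS

/-- The generator `a`. -/
def a (n : ℕ) : BS n := PresentedGroup.of 0

/-- The generator `t`. -/
def t (n : ℕ) : BS n := PresentedGroup.of 1

end BS

/-- The polynomial `x^(k+1) - x^k - 2 x^(k-1) - ⋯ - 2 x - 2`. -/
noncomputable def growthPoly (k : ℕ) : ℝ[X] :=
  X ^ (k + 1) - X ^ k - ∑ i ∈ Finset.range k, C 2 * X ^ i

/-- `r` is the unique positive root of `P`. -/
def IsUniquePositiveRoot (P : ℝ[X]) (r : ℝ) : Prop :=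
  0 < r ∧ P.IsRoot r ∧ ∀ s : ℝ, 0 < s → P.IsRoot s → s = r

/-!
Both groups act affinely on a field `K`, namely `𝔽_p((X))` or `ℚ_p`: the generator `a` is the
translation `u ↦ u + 1` and `t` is the multiplication `u ↦ π * u` with the uniformizer `π`.

*Lower bound.* If words of lengths `ℓ i` map a set into itself with pairwise disjoint images, they
freely generate a semigroup, and `∑ r ^ ℓ i ≥ 1` forces `ω ≥ r⁻¹`. Any generating set contains, up
to inversion and conjugation, two elements `x : u ↦ π ^ h₁ * u` and `y : u ↦ π ^ h₂ * u + 1` with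
`h₁ > 0` and either `h₂ = 0` or `h₂ ≥ h₁`. For `h₂ = 0` the words `y ^ i * x`, with `i` in a set of
representatives modulo `p`, have disjoint images; in `ℚ_2` the words `x` and `y ^ i * x ^ 2` with
`i = ±1` do better, since there `1` and `-1` agree modulo `2` but not modulo `4`. For `h₂ = h₁` the
words `(y * x⁻¹) ^ i * x` play the role of `y ^ i * x`. If `h₂ > 0` and `r⁻¹ ≤ 2`, the words `x` and
`y` suffice. For `h₂ > h₁` and larger `p`, the ping-pong consists of infinitely many products of
words `x ^ i * y` and `x ^ i * y⁻¹`, which are told apart by their leading terms in `π`.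

*Upper bound.* Up to powers of `t` on both sides, an element of length `n` has a digit expansion
`a ^ c₁ * t * a ^ c₂ * t * ⋯` of cost at most `n`. Carrying to the next digit at no additional cost
makes every digit balanced, `|c| ≤ k` for `p = 2 * k + 1`, and for `BS(1, 2)` puts the expansion in
non-adjacent form. The expansions in reduced form are counted by a linear recursion, whose growth
rate is the one of the lower bound.
-/

/-! ### Growth rates and ping-pong -/

namespace GroupGrowth

section Ball

variable {G : Type*} [Group G] {S : Set G}

theorem one_mem_ball (S : Set G) (n : ℕ) : (1 : G) ∈ ball S n :=
  mem_ball_iff.mpr ⟨[], by simp⟩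

theorem ball_mono (S : Set G) {m n : ℕ} (h : m ≤ n) : ball S m ⊆ ball S n := by
  intro g (hg : wordLength S g ≤ m)
  exact hg.trans (Nat.cast_le.mpr h)

theorem subset_ball_one (S : Set G) : S ⊆ ball S 1 := fun s hs ↦
  mem_ball_iff.mpr ⟨[s], by simpa using Or.inl hs⟩

theorem mul_mem_ball {m n : ℕ} {g h : G} (hg : g ∈ ball S m) (hh : h ∈ ball S n) :
    g * h ∈ ball S (m + n) := by
  obtain ⟨l, hl, rfl, hlm⟩ := mem_ball_iff.mp hg
  obtain ⟨l', hl', rfl, hln⟩ := mem_ball_iff.mp hh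
  refine mem_ball_iff.mpr ⟨l ++ l', fun s hs ↦ ?_, List.prod_append, ?_⟩
  · exact (List.mem_append.mp hs).elim (hl s) (hl' s)
  · rw [List.length_append]
    exact Nat.add_le_add hlm hln

theorem inv_mem_ball {n : ℕ} {g : G} (hg : g ∈ ball S n) : g⁻¹ ∈ ball S n := by
  obtain ⟨l, hl, rfl, hln⟩ := mem_ball_iff.mp hg
  refine mem_ball_iff.mpr ⟨(l.map (·⁻¹)).reverse, fun s hs ↦ ?_, l.prod_inv_reverse.symm, ?_⟩
  · obtain ⟨u, hu, rfl⟩ := List.mem_map.mp (List.mem_reverse.mp hs)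
    simpa only [inv_inv] using (hl u hu).symm
  · simpa using hln

theorem pow_mem_ball {m : ℕ} {g : G} (hg : g ∈ ball S m) (n : ℕ) : g ^ n ∈ ball S (n * m) := by
  induction n with
  | zero => simpa using one_mem_ball S 0
  | succ n ih => simpa only [pow_succ, Nat.succ_mul] using mul_mem_ball ih hg

theorem zpow_mem_ball {m : ℕ} {g : G} (hg : g ∈ ball S m) (n : ℤ) :
    g ^ n ∈ ball S (n.natAbs * m) := by
  obtain ⟨k, rfl | rfl⟩ := n.eq_nat_or_neg
  · simpa using pow_mem_ball hg k
  · simpa using inv_mem_ball (pow_mem_ball hg k)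

theorem listProd_ofFn_mem_ball {ι : Type*} {w : ι → G} {ℓ : ι → ℕ} (hw : ∀ i, w i ∈ ball S (ℓ i))
    {n : ℕ} (l : Fin n → ι) : (List.ofFn fun j ↦ w (l j)).prod ∈ ball S (∑ j, ℓ (l j)) := by
  induction n with
  | zero => simpa using one_mem_ball S 0
  | succ n ih =>
    rw [List.ofFn_succ, List.prod_cons, Fin.sum_univ_succ]
    exact mul_mem_ball (hw _) (ih fun j ↦ l j.succ)

end Ball

section GrowthRate

variable {G : Type*} [Group G] {S : Set G}

theorem growthRate_le_of_eventually_le (hS : S.Finite) {ρ : ℝ} (hρ : 0 < ρ)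
    (h : ∀ᶠ n in atTop, (growthFunction S n : ℝ) ≤ ρ ^ n) : growthRate S ≤ ρ := by
  refine le_of_tendsto (tendsto_growthRate hS) ?_
  filter_upwards [h, eventually_gt_atTop 0] with n hn hn0
  rw [one_div, Real.rpow_inv_le_iff_of_pos (Nat.cast_nonneg _) hρ.le (by positivity),
    Real.rpow_natCast]
  exact hn

theorem growthRate_le (hS : S.Finite) {z C : ℝ} (hz : 0 < z) (d : ℕ)
    (h : ∀ n : ℕ, (growthFunction S n : ℝ) ≤ C * ((n : ℝ) + 1) ^ d * z ^ n) :
    growthRate S ≤ z := by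
  refine le_of_forall_gt_imp_ge_of_dense fun ρ hzρ ↦
    growthRate_le_of_eventually_le hS (hz.trans hzρ) ?_
  have hρ : 0 < ρ := hz.trans hzρ
  have hlim : Tendsto (fun n : ℕ ↦ C * (ρ / z) * (((n + 1 : ℕ) : ℝ) ^ d * (z / ρ) ^ (n + 1)))
      atTop (𝓝 0) := by
    have hratio : |z / ρ| < 1 := by rwa [abs_of_pos (by positivity), div_lt_one hρ]
    simpa only [mul_zero] using ((tendsto_add_atTop_iff_nat 1).mpr
      (tendsto_pow_const_mul_const_pow_of_abs_lt_one d hratio)).const_mul (C * (ρ / z))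
  filter_upwards [hlim.eventually_le_const one_pos] with n hn
  calc (growthFunction S n : ℝ) ≤ C * ((n : ℝ) + 1) ^ d * z ^ n := h n
    _ = C * (ρ / z) * (((n + 1 : ℕ) : ℝ) ^ d * (z / ρ) ^ (n + 1)) * ρ ^ n := by
      push_cast
      rw [pow_succ (z / ρ), div_pow]
      field_simp
    _ ≤ ρ ^ n := mul_le_of_le_one_left (by positivity) hn

theorem summable_growthFunction_mul_pow (hS : S.Finite) {x : ℝ} (hx : 0 < x)
    (h : growthRate S * x < 1) : Summable fun n : ℕ ↦ growthFunction S n * x ^ n := by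
  obtain ⟨ρ, hωρ, hρx⟩ := exists_between ((lt_div_iff₀ hx).mpr h)
  have hρ : 0 < ρ := one_pos.trans_le ((one_le_growthRate hS).trans hωρ.le)
  have hgeom : Summable fun n : ℕ ↦ (ρ * x) ^ n :=
    summable_geometric_of_lt_one (by positivity) ((lt_div_iff₀ hx).mp hρx)
  refine hgeom.of_norm_bounded_eventually_nat ?_
  filter_upwards [(tendsto_growthRate hS).eventually_le_const hωρ, eventually_gt_atTop 0]
    with n hn hn0
  rw [one_div, Real.rpow_inv_le_iff_of_pos (Nat.cast_nonneg _) hρ.le (by positivity),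
    Real.rpow_natCast] at hn
  rw [Real.norm_of_nonneg (by positivity), mul_pow]
  gcongr

theorem sum_pow_le_sum_growthFunction_mul_pow (hS : S.Finite) {κ : Type*} {W : κ → G}
    (hW : W.Injective) {L : κ → ℕ} (hL : ∀ l, W l ∈ ball S (L l)) {x : ℝ} (hx : 0 ≤ x)
    (T : Finset κ) : ∑ l ∈ T, x ^ L l ≤ ∑ m ∈ T.image L, growthFunction S m * x ^ m := by
  classical
  rw [← Finset.sum_fiberwise_of_maps_to fun l hl ↦ Finset.mem_image_of_mem L hl]
  refine Finset.sum_le_sum fun m _ ↦ ?_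
  have hcard : (T.filter fun l ↦ L l = m).card ≤ growthFunction S m := by
    rw [← Set.ncard_coe_finset]
    refine Set.ncard_le_ncard_of_injOn W (fun l hl ↦ ?_) hW.injOn (ball_finite hS m)
    exact (Finset.mem_filter.mp hl).2 ▸ hL l
  calc ∑ l ∈ T with L l = m, x ^ L l = ∑ l ∈ T with L l = m, x ^ m :=
        Finset.sum_congr rfl fun l hl ↦ by rw [(Finset.mem_filter.mp hl).2]
    _ = (T.filter fun l ↦ L l = m).card * x ^ m := by rw [Finset.sum_const, nsmul_eq_mul]
    _ ≤ growthFunction S m * x ^ m := by gcongr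

end GrowthRate

/-- The family `w` plays ping-pong from `X` to `Y` under the action `φ`: the images of `X` under
the `w i` are pairwise disjoint subsets of `Y`. Separate source and target make such families
composable. -/
structure IsPingPong {G α ι : Type*} [Group G] (φ : G →* Equiv.Perm α) (X Y : Set α) (w : ι → G) :
    Prop where
  mapsTo (i : ι) : Set.MapsTo (φ (w i)) X Y
  pairwise_disjoint : Pairwise fun i j ↦ Disjoint (φ (w i) '' X) (φ (w j) '' X)

namespace IsPingPong

variable {G α ι κ : Type*} [Group G] {φ : G →* Equiv.Perm α} {X Y Z : Set α} {w : ι → G}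
  {v : κ → G}

theorem mono (h : IsPingPong φ X Y w) (hYZ : Y ⊆ Z) : IsPingPong φ X Z w :=
  ⟨fun i ↦ (h.mapsTo i).mono_right hYZ, h.pairwise_disjoint⟩

theorem comp (h : IsPingPong φ X Y w) {f : κ → ι} (hf : f.Injective) :
    IsPingPong φ X Y fun k ↦ w (f k) :=
  ⟨fun k ↦ h.mapsTo (f k), fun _ _ hij ↦ h.pairwise_disjoint (hf.ne hij)⟩

theorem mul (hv : IsPingPong φ Y Z v) (hw : IsPingPong φ X Y w) :
    IsPingPong φ X Z fun p : κ × ι ↦ v p.1 * w p.2 := by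
  have himage (p : κ × ι) : φ (v p.1 * w p.2) '' X = φ (v p.1) '' (φ (w p.2) '' X) := by
    rw [map_mul, Equiv.Perm.coe_mul, Set.image_comp]
  refine ⟨fun p ↦ ?_, ?_⟩
  · rw [map_mul, Equiv.Perm.coe_mul]
    exact (hv.mapsTo p.1).comp (hw.mapsTo p.2)
  · rintro ⟨k, i⟩ ⟨k', i'⟩ hne
    rw [himage, himage]
    rcases eq_or_ne k k' with rfl | hk
    · exact (Set.disjoint_image_iff (φ (v k)).injective).mpr
        (hw.pairwise_disjoint fun hi ↦ hne (Prod.ext rfl hi))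
    · exact (hv.pairwise_disjoint hk).mono (Set.image_mono (hw.mapsTo i).image_subset)
        (Set.image_mono (hw.mapsTo i').image_subset)

theorem sumElim (hw : IsPingPong φ X Y w) (hv : IsPingPong φ X Z v) (hYZ : Disjoint Y Z) :
    IsPingPong φ X (Y ∪ Z) (Sum.elim w v) where
  mapsTo := by
    rintro (i | k)
    · exact (hw.mapsTo i).mono_right Set.subset_union_left
    · exact (hv.mapsTo k).mono_right Set.subset_union_right
  pairwise_disjoint := by
    rintro (i | k) (j | l) hne
    · exact hw.pairwise_disjoint fun h ↦ hne (congrArg Sum.inl h)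
    · exact hYZ.mono (hw.mapsTo i).image_subset (hv.mapsTo l).image_subset
    · exact hYZ.symm.mono (hv.mapsTo k).image_subset (hw.mapsTo j).image_subset
    · exact hv.pairwise_disjoint fun h ↦ hne (congrArg Sum.inr h)

theorem listProd_ofFn (h : IsPingPong φ X X w) (n : ℕ) :
    IsPingPong φ X X fun l : Fin n → ι ↦ (List.ofFn fun j ↦ w (l j)).prod := by
  induction n with
  | zero =>
    exact ⟨fun _ ↦ by simpa using Set.mapsTo_id X,
      fun l l' hne ↦ absurd (Subsingleton.elim l l') hne⟩
  | succ n ih =>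
    simp only [List.ofFn_succ, List.prod_cons]
    exact (h.mul ih).comp (Fin.consEquiv fun _ : Fin (n + 1) ↦ ι).symm.injective

theorem injective (h : IsPingPong φ X Y w) (hX : X.Nonempty) : w.Injective := by
  intro i j hij
  by_contra hne
  have hdisj : Disjoint (φ (w i) '' X) (φ (w j) '' X) := h.pairwise_disjoint hne
  rw [hij, disjoint_self] at hdisj
  exact (hX.image _).ne_empty hdisj

theorem inv_le_growthRate (h : IsPingPong φ X X w) (hX : X.Nonempty) {S : Set G} (hS : S.Finite)
    {ℓ : ι → ℕ} (hw : ∀ i, w i ∈ ball S (ℓ i)) (hℓ : ∀ i, 1 ≤ ℓ i) {x : ℝ} (hx : 0 < x)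
    {s : Finset ι} (hsum : 1 ≤ ∑ i ∈ s, x ^ ℓ i) : x⁻¹ ≤ growthRate S := by
  classical
  by_contra! hlt
  have hsummable := summable_growthFunction_mul_pow hS hx (by rwa [← lt_div_iff₀ hx, one_div])
  obtain ⟨s₀, htail⟩ := summable_iff_vanishing_norm.mp hsummable 1 one_pos
  obtain ⟨n, hn⟩ : ∃ n, ∀ m ∈ s₀, m < n := ⟨s₀.sup id + 1, fun m hm ↦
    Nat.lt_succ_of_le (Finset.le_sup (f := id) hm)⟩
  set T := Fintype.piFinset fun _ : Fin n ↦ s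
  set L : (Fin n → ι) → ℕ := fun l ↦ ∑ j, ℓ (l j)
  have hnL (l) : n ≤ L l := by simpa using Finset.sum_le_sum fun j (_ : j ∈ Finset.univ) ↦ hℓ (l j)
  have hdisj : Disjoint (T.image L) s₀ := by
    refine Finset.disjoint_left.mpr fun m hm hm₀ ↦ ?_
    obtain ⟨l, -, rfl⟩ := Finset.mem_image.mp hm
    exact (hn _ hm₀).not_ge (hnL l)
  have hone : 1 ≤ ∑ l ∈ T, x ^ L l := by
    have := one_le_pow₀ hsum (n := n)
    rw [Finset.sum_pow'] at this
    simpa only [Finset.prod_pow_eq_pow_sum] using this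
  exact (hone.trans (sum_pow_le_sum_growthFunction_mul_pow hS ((h.listProd_ofFn n).injective hX)
    (listProd_ofFn_mem_ball hw) hx.le T)).not_gt ((le_abs_self _).trans_lt (htail _ hdisj))

theorem inv_le_growthRate_of_hasSum (h : IsPingPong φ X X w) (hX : X.Nonempty) {S : Set G}
    (hS : S.Finite) {ℓ : ι → ℕ} (hw : ∀ i, w i ∈ ball S (ℓ i)) (hℓ : ∀ i, 1 ≤ ℓ i) {x : ℝ}
    (hx : 0 < x) {σ : ℝ} (hsum : HasSum (fun i ↦ x ^ ℓ i) σ) (hσ : 1 < σ) :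
    x⁻¹ ≤ growthRate S := by
  obtain ⟨s, hs⟩ := (hsum.eventually_const_lt hσ).exists
  exact h.inv_le_growthRate hX hS hw hℓ hx hs.le

end IsPingPong

end GroupGrowth

/-! ### Digit expansions -/

namespace GroupGrowth

variable {G : Type*} [Group G]

/-- `DigitExpansion a t L n g`: the element `g` is of the form
`a ^ c₁ * t * a ^ c₂ * t * ⋯ * a ^ c_L * t * a ^ e` with `L + |c₁| + ⋯ + |c_L| + |e| ≤ n`. These
are the words whose number is estimated in the upper bounds for the growth rate. -/
inductive DigitExpansion (a t : G) : ℕ → ℕ → G → Prop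
  | base (e : ℤ) (n : ℕ) (h : e.natAbs ≤ n) : DigitExpansion a t 0 n (a ^ e)
  | step (c : ℤ) {L m n : ℕ} {g : G} (hg : DigitExpansion a t L m g)
      (h : c.natAbs + 1 + m ≤ n) : DigitExpansion a t (L + 1) n (a ^ c * t * g)

namespace DigitExpansion

variable {a t : G} {L m n : ℕ} {g : G}

theorem mono (h : DigitExpansion a t L m g) (hmn : m ≤ n) : DigitExpansion a t L n g := by
  cases h with
  | base e _ h => exact base e n (h.trans hmn)
  | step c hg h => exact step c hg (h.trans hmn)

theorem zpow_mul (h : DigitExpansion a t L m g) (q : ℤ) :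
    DigitExpansion a t L (m + q.natAbs) (a ^ q * g) := by
  cases h with
  | base e _ h =>
    rw [← zpow_add]
    exact base _ _ ((Int.natAbs_add_le q e).trans (by omega))
  | step c hg h =>
    rw [← mul_assoc, ← mul_assoc, ← zpow_add]
    exact step _ hg (by have := Int.natAbs_add_le q c; omega)

theorem mul_left (h : DigitExpansion a t L m g) : DigitExpansion a t (L + 1) (m + 1) (t * g) := by
  simpa using step 0 h (n := m + 1) (by rw [Int.natAbs_zero]; omega)

theorem mul_right (h : DigitExpansion a t L m g) :
    DigitExpansion a t (L + 1) (m + 1) (g * t) := by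
  induction h with
  | base e n h => simpa using step e (base (t := t) (a := a) 0 0 (by simp)) (n := n + 1) (by omega)
  | step c hg h ih =>
    rw [mul_assoc]
    exact step c ih (by omega)

theorem conj_mul (hcomm : ∀ i : ℕ, Commute (t ^ i * a * (t ^ i)⁻¹) a)
    (h : DigitExpansion a t L m g) {A : ℕ} (hA : A ≤ L) (q : ℤ) :
    DigitExpansion a t L (m + q.natAbs) (t ^ A * a ^ q * (t ^ A)⁻¹ * g) := by
  induction h generalizing A with
  | base e n h =>
    obtain rfl : A = 0 := by omega
    simpa using (base (t := t) e n h).zpow_mul q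
  | @step c L m n g hg h ih =>
    cases A with
    | zero => simpa using (step c hg h).zpow_mul q
    | succ A =>
      have hc : Commute (t ^ (A + 1) * a ^ q * (t ^ (A + 1))⁻¹) (a ^ c) := by
        rw [← conj_zpow]
        exact (hcomm (A + 1)).zpow_zpow q c
      have hmove : t ^ (A + 1) * a ^ q * (t ^ (A + 1))⁻¹ * (a ^ c * t * g) =
          a ^ c * t * (t ^ A * a ^ q * (t ^ A)⁻¹ * g) := by
        rw [mul_assoc (a ^ c), ← mul_assoc _ (a ^ c), hc.eq, pow_succ']
        group
      rw [hmove]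
      exact step c (ih (by omega)) (by omega)

theorem mem_ball (h : DigitExpansion a t L n g) : g ∈ ball {a, t} n := by
  have ha (c : ℤ) : a ^ c ∈ ball {a, t} c.natAbs := by
    simpa using zpow_mem_ball (subset_ball_one {a, t} (Set.mem_insert a {t})) c
  induction h with
  | base e n h => exact ball_mono _ h (ha e)
  | step c _ h ih =>
    exact ball_mono _ h
      (mul_mem_ball (mul_mem_ball (ha c) (subset_ball_one {a, t} (Or.inr rfl))) ih)

end DigitExpansion

theorem letter_cases {a t s : G} (hs : s ∈ ({a, t} : Set G) ∨ s⁻¹ ∈ ({a, t} : Set G)) :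
    (∃ q : ℤ, q.natAbs = 1 ∧ s = a ^ q) ∨ s = t ∨ s = t⁻¹ := by
  rcases hs with (rfl | rfl) | (rfl | h)
  · exact .inl ⟨1, by simp⟩
  · exact .inr (.inl rfl)
  · exact .inl ⟨-1, by simp⟩
  · exact .inr (.inr (inv_eq_iff_eq_inv.mp h))

theorem exists_digitExpansion_of_mem_ball {a t : G}
    (hcomm : ∀ i : ℕ, Commute (t ^ i * a * (t ^ i)⁻¹) a) {n : ℕ} {g : G}
    (hg : g ∈ ball {a, t} n) :
    ∃ A L : ℕ, ∃ m : ℤ, ∃ d : G, A ≤ L ∧ L ≤ n ∧ m.natAbs ≤ n ∧ DigitExpansion a t L n d ∧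
      g = (t ^ A)⁻¹ * d * t ^ m := by
  obtain ⟨l, hl, rfl, hn⟩ := mem_ball_iff.mp hg
  clear hg
  induction l generalizing n with
  | nil =>
    exact ⟨0, 0, 0, 1, le_rfl, by simp, by simp,
      by simpa using DigitExpansion.base (a := a) (t := t) 0 n (by simp), by simp⟩
  | cons s l ih =>
    obtain ⟨n, rfl⟩ := Nat.exists_eq_succ_of_ne_zero (Nat.ne_zero_of_lt hn)
    obtain ⟨A, L, m, d, hA, hL, hm, hd, he⟩ :=
      ih (fun s hs ↦ hl s (List.mem_cons_of_mem _ hs)) (Nat.le_of_succ_le_succ hn)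
    rw [List.prod_cons, he]
    rcases letter_cases (hl s List.mem_cons_self) with ⟨q, hq, rfl⟩ | rfl | rfl
    · refine ⟨A, L, m, t ^ A * a ^ q * (t ^ A)⁻¹ * d, hA, by omega, by omega, ?_, by group⟩
      simpa only [hq] using hd.conj_mul hcomm hA q
    · cases A with
      | zero =>
        exact ⟨0, L + 1, m, s * d, by omega, by omega, by omega, hd.mul_left,
          by simp [mul_assoc]⟩
      | succ A =>
        exact ⟨A, L, m, d, by omega, by omega, by omega, hd.mono (by omega),
          by rw [pow_succ]; group⟩
    · by_cases h : A + 1 ≤ L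
      · exact ⟨A + 1, L, m, d, h, by omega, by omega, hd.mono (by omega), by rw [pow_succ]; group⟩
      · exact ⟨A + 1, L + 1, m - 1, d * t, by omega, by omega, by omega, hd.mul_right,
          by rw [pow_succ]; group⟩

/-- The elements with a digit expansion of cost at most `n`. Up to polynomial factors, their number
is the growth function. -/
def digitSet (a t : G) (n : ℕ) : Set G := {g | ∃ L, DigitExpansion a t L n g}

/-- The elements `a ^ c * t ^ b * a ^ e` with `b ∈ {0, 1}` and `|c|, |e| ≤ n`: the expansions with
at most one digit, at which the recursive counting of digit expansions stops. -/
def shortDigitSet (a t : G) (n : ℕ) : Set G :=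
  (fun x : ℤ × ℕ × ℤ ↦ a ^ x.1 * t ^ x.2.1 * a ^ x.2.2) ''
    ↑(Finset.Icc (-n : ℤ) n ×ˢ Finset.range 2 ×ˢ Finset.Icc (-n : ℤ) n)

theorem finite_digitSet (a t : G) (n : ℕ) : (digitSet a t n).Finite :=
  (ball_finite (by simp : ({a, t} : Set G).Finite) n).subset fun _ ⟨_, h⟩ ↦ h.mem_ball

theorem zpow_mem_shortDigitSet (a t : G) {n : ℕ} {e : ℤ} (he : e.natAbs ≤ n) :
    a ^ e ∈ shortDigitSet a t n :=
  ⟨(0, 0, e), by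
    simp only [Finset.coe_product, Set.mem_prod, Finset.mem_coe, Finset.mem_Icc, Finset.mem_range]
    omega, by simp⟩

theorem zpow_mul_mul_zpow_mem_shortDigitSet (a t : G) {n : ℕ} {c e : ℤ} (hc : c.natAbs ≤ n)
    (he : e.natAbs ≤ n) : a ^ c * t * a ^ e ∈ shortDigitSet a t n :=
  ⟨(c, 1, e), by
    simp only [Finset.coe_product, Set.mem_prod, Finset.mem_coe, Finset.mem_Icc, Finset.mem_range]
    omega, by simp⟩

theorem finite_shortDigitSet (a t : G) (n : ℕ) : (shortDigitSet a t n).Finite :=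
  (Finset.finite_toSet _).image _

theorem ncard_shortDigitSet_le (a t : G) (n : ℕ) :
    (shortDigitSet a t n).ncard ≤ 2 * (2 * n + 1) ^ 2 := by
  refine (Set.ncard_image_le (Finset.finite_toSet _)).trans_eq ?_
  rw [Set.ncard_coe_finset, Finset.card_product, Finset.card_product, Int.card_Icc,
    Finset.card_range, show ((n : ℤ) + 1 - -n).toNat = 2 * n + 1 by omega]
  ring

theorem growthFunction_le_ncard_digitSet {a t : G}
    (hcomm : ∀ i : ℕ, Commute (t ^ i * a * (t ^ i)⁻¹) a) (n : ℕ) :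
    growthFunction {a, t} n ≤ (n + 1) * (2 * n + 1) * (digitSet a t n).ncard := by
  set P : Set ((ℕ × ℤ) × G) :=
    (↑(Finset.range (n + 1) ×ˢ Finset.Icc (-n : ℤ) n) : Set (ℕ × ℤ)) ×ˢ digitSet a t n
  have hfin : P.Finite := (Finset.finite_toSet _).prod (finite_digitSet a t n)
  have hcard : P.ncard = (n + 1) * (2 * n + 1) * (digitSet a t n).ncard := by
    rw [Set.ncard_prod, Set.ncard_coe_finset, Finset.card_product, Finset.card_range, Int.card_Icc,
      show ((n : ℤ) + 1 - -n).toNat = 2 * n + 1 by omega]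
  rw [← hcard]
  refine le_trans (Set.ncard_le_ncard ?_ (hfin.image fun x ↦ (t ^ x.1.1)⁻¹ * x.2 * t ^ x.1.2))
    (Set.ncard_image_le hfin)
  intro g hg
  obtain ⟨A, L, m, d, hA, hL, hm, hd, rfl⟩ := exists_digitExpansion_of_mem_ball hcomm hg
  refine ⟨((A, m), d), ⟨?_, L, hd⟩, rfl⟩
  simp only [Finset.coe_product, Set.mem_prod, Finset.coe_range, Set.mem_Iio, Finset.coe_Icc,
    Set.mem_Icc]
  omega

theorem le_mul_pow_of_recursion {ι : Type*} {s : Finset ι} {ℓ : ι → ℕ} (hℓ : ∀ i, 1 ≤ ℓ i)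
    {u b : ℕ → ℝ} (hb : Monotone b) (hb₀ : 0 ≤ b 0)
    (hu : ∀ n, u n ≤ b n + ∑ i ∈ s with ℓ i ≤ n, u (n - ℓ i))
    {z : ℝ} (hz : 1 ≤ z) (hs : ∑ i ∈ s, z⁻¹ ^ ℓ i ≤ 1) (n : ℕ) :
    u n ≤ b n * (n + 1) * z ^ n := by
  induction n using Nat.strong_induction_on with
  | _ n ih =>
  have hbn : 0 ≤ b n := hb₀.trans (hb n.zero_le)
  have hterm : ∀ i ∈ s.filter (ℓ · ≤ n), u (n - ℓ i) ≤ b n * n * z ^ n * z⁻¹ ^ ℓ i := by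
    intro i hi
    have hin := (Finset.mem_filter.mp hi).2
    have hcast : ((n - ℓ i : ℕ) : ℝ) + 1 ≤ n := by exact_mod_cast (by have := hℓ i; omega)
    calc u (n - ℓ i) ≤ b (n - ℓ i) * ((n - ℓ i : ℕ) + 1) * z ^ (n - ℓ i) :=
          ih _ (by have := hℓ i; omega)
      _ ≤ b n * n * z ^ (n - ℓ i) := by
          gcongr
          exact hb (n.sub_le _)
      _ = b n * n * z ^ n * z⁻¹ ^ ℓ i := by
          rw [pow_sub₀ z (by positivity) hin, inv_pow, mul_assoc _ (z ^ n)]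
  have hsum : ∑ i ∈ s with ℓ i ≤ n, z⁻¹ ^ ℓ i ≤ 1 :=
    (Finset.sum_le_sum_of_subset_of_nonneg (Finset.filter_subset _ _)
      fun i _ _ ↦ by positivity).trans hs
  calc u n ≤ b n + ∑ i ∈ s with ℓ i ≤ n, u (n - ℓ i) := hu n
    _ ≤ b n + ∑ i ∈ s with ℓ i ≤ n, b n * n * z ^ n * z⁻¹ ^ ℓ i := by
        gcongr 1
        exact Finset.sum_le_sum hterm
    _ ≤ b n * z ^ n + b n * n * z ^ n := by
        rw [← Finset.mul_sum]
        exact add_le_add (le_mul_of_one_le_right hbn (one_le_pow₀ hz))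
          (mul_le_of_le_one_right (by positivity) hsum)
    _ = b n * (n + 1) * z ^ n := by ring

theorem ncard_digitSet_le_of_recursion {a t : G} {ι : Type*} {s : Finset ι} {w : ι → G} {ℓ : ι → ℕ}
    {n : ℕ} (hf : ∀ g ∈ digitSet a t n, g ∈ shortDigitSet a t n ∨
      ∃ i ∈ s, ℓ i ≤ n ∧ ∃ h ∈ digitSet a t (n - ℓ i), g = w i * h) :
    (digitSet a t n).ncard ≤
      2 * (2 * n + 1) ^ 2 + ∑ i ∈ s with ℓ i ≤ n, (digitSet a t (n - ℓ i)).ncard := by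
  classical
  set V : ι → Set G := fun i ↦ (w i * ·) '' digitSet a t (n - ℓ i)
  have hsub : digitSet a t n ⊆ shortDigitSet a t n ∪ ⋃ i ∈ s.filter (ℓ · ≤ n), V i := by
    intro g hg
    rcases hf g hg with h | ⟨i, hi, hin, h, hh, rfl⟩
    · exact .inl h
    · exact .inr (Set.mem_biUnion (Finset.mem_filter.mpr ⟨hi, hin⟩) ⟨h, hh, rfl⟩)
  have hfin : (⋃ i ∈ s.filter (ℓ · ≤ n), V i).Finite :=
    (Finset.finite_toSet _).biUnion fun i _ ↦ (finite_digitSet a t _).image _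
  calc (digitSet a t n).ncard
      ≤ (shortDigitSet a t n).ncard + (⋃ i ∈ s.filter (ℓ · ≤ n), V i).ncard :=
        (Set.ncard_le_ncard hsub ((finite_shortDigitSet a t n).union hfin)).trans
          (Set.ncard_union_le _ _)
    _ ≤ 2 * (2 * n + 1) ^ 2 + ∑ i ∈ s with ℓ i ≤ n, (V i).ncard :=
        add_le_add (ncard_shortDigitSet_le a t n) (Finset.set_ncard_biUnion_le _ _)
    _ ≤ _ := by
        gcongr 2 with i
        exact Set.ncard_image_le (finite_digitSet a t _)

theorem growthRate_le_of_recursion {a t : G}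
    (hcomm : ∀ i : ℕ, Commute (t ^ i * a * (t ^ i)⁻¹) a) {ι : Type*} {s : Finset ι} {w : ι → G}
    {ℓ : ι → ℕ} (hℓ : ∀ i, 1 ≤ ℓ i)
    (hf : ∀ n, ∀ g ∈ digitSet a t n, g ∈ shortDigitSet a t n ∨
      ∃ i ∈ s, ℓ i ≤ n ∧ ∃ h ∈ digitSet a t (n - ℓ i), g = w i * h)
    {z : ℝ} (hz : 1 ≤ z) (hs : ∑ i ∈ s, z⁻¹ ^ ℓ i ≤ 1) :
    growthRate {a, t} ≤ z := by
  have hcount (n : ℕ) : ((digitSet a t n).ncard : ℝ) ≤ 2 * (2 * n + 1) ^ 2 * (n + 1) * z ^ n := by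
    refine le_mul_pow_of_recursion (s := s) (ℓ := ℓ) hℓ
      (u := fun n ↦ ((digitSet a t n).ncard : ℝ)) (b := fun n ↦ 2 * (2 * n + 1) ^ 2)
      (fun m n hmn ↦ by dsimp only; gcongr) (by norm_num) (fun n ↦ ?_) hz hs n
    exact_mod_cast ncard_digitSet_le_of_recursion (hf n)
  refine growthRate_le (by simp) (C := 16) (by positivity) 5 fun n ↦ ?_
  calc (growthFunction {a, t} n : ℝ)
      ≤ ((n : ℝ) + 1) * (2 * n + 1) * (digitSet a t n).ncard := by
        exact_mod_cast growthFunction_le_ncard_digitSet hcomm n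
    _ ≤ ((n : ℝ) + 1) * (2 * n + 1) * (2 * (2 * n + 1) ^ 2 * (n + 1) * z ^ n) := by
        gcongr
        exact hcount n
    _ = 2 * (2 * n + 1) ^ 3 * (n + 1) ^ 2 * z ^ n := by ring
    _ ≤ 2 * (2 * (n + 1)) ^ 3 * (n + 1) ^ 2 * z ^ n := by gcongr; linarith
    _ = 16 * ((n : ℝ) + 1) ^ 5 * z ^ n := by ring

theorem growthRate_le_of_digits {a t : G}
    (hcomm : ∀ i : ℕ, Commute (t ^ i * a * (t ^ i)⁻¹) a) {s : Finset ℤ}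
    (hred : ∀ c : ℤ, ∃ i ∈ s, ∃ q : ℤ, a ^ c * t = a ^ i * t * a ^ q ∧
      i.natAbs + q.natAbs ≤ c.natAbs)
    {z : ℝ} (hz : 1 ≤ z) (hs : ∑ i ∈ s, z⁻¹ ^ (i.natAbs + 1) ≤ 1) :
    growthRate {a, t} ≤ z := by
  refine growthRate_le_of_recursion hcomm (w := fun i : ℤ ↦ a ^ i * t) (fun i ↦ by omega)
    (fun n g ⟨L, hL⟩ ↦ ?_) hz hs
  cases hL with
  | base e _ h => exact .inl (zpow_mem_shortDigitSet a t h)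
  | @step c L m n g hg h =>
    obtain ⟨i, hi, q, he, hq⟩ := hred c
    refine .inr ⟨i, hi, by omega, a ^ q * g, ⟨L, (hg.zpow_mul q).mono (by omega)⟩, ?_⟩
    rw [he, mul_assoc _ (a ^ q)]

/- The sign of the digit `i` replacing an odd `c` is chosen such that the next digit becomes even:
this is the recoding of binary expansions into non-adjacent form. -/
theorem exists_nonadjacent_digit {c : ℤ} (hc : Odd c) (c' : ℤ) :
    ∃ i q r : ℤ, i.natAbs = 1 ∧ c = i + 2 * q ∧ q + c' = 2 * r ∧
      r.natAbs + 1 ≤ c.natAbs + c'.natAbs := by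
  obtain ⟨q, rfl⟩ := hc
  rcases Int.even_or_odd' (q + c') with ⟨r, hr | hr⟩
  · exact ⟨1, q, r, rfl, by omega, hr, by omega⟩
  · exact ⟨-1, q + 1, r + 1, rfl, by omega, by omega, by omega⟩

theorem sum_Icc_neg_one_one_pow (r : ℝ) :
    ∑ i ∈ Finset.Icc (-1 : ℤ) 1, r ^ (2 * i.natAbs + 1) = r + 2 * r ^ 3 := by
  have hIcc : Finset.Icc (-1 : ℤ) 1 = {-1, 0, 1} := rfl
  rw [hIcc, Finset.sum_insert (by decide), Finset.sum_insert (by decide), Finset.sum_singleton]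
  norm_num only [Int.natAbs_neg, Int.natAbs_one, Int.natAbs_zero]
  ring

theorem growthRate_le_of_nonadjacent {a t : G} (hrel : ∀ q : ℤ, a ^ (2 * q) * t = t * a ^ q)
    (hcomm : ∀ i : ℕ, Commute (t ^ i * a * (t ^ i)⁻¹) a)
    {z : ℝ} (hz : 1 ≤ z) (hs : z⁻¹ + 2 * z⁻¹ ^ 3 ≤ 1) :
    growthRate {a, t} ≤ z := by
  refine growthRate_le_of_recursion hcomm (s := Finset.Icc (-1) 1)
    (w := fun i : ℤ ↦ a ^ i * t ^ (i.natAbs + 1)) (ℓ := fun i ↦ 2 * i.natAbs + 1)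
    (fun i ↦ by omega) (fun n g ⟨L, hL⟩ ↦ ?_) hz ?_
  · cases hL with
    | base e _ h => exact .inl (zpow_mem_shortDigitSet a t h)
    | @step c L m n g hg h =>
    rcases Int.even_or_odd' c with ⟨q, rfl | hc⟩
    · refine .inr ⟨0, by simp, by rw [Int.natAbs_zero]; omega, a ^ q * g,
        ⟨L, (hg.zpow_mul q).mono (by rw [Int.natAbs_zero]; omega)⟩, ?_⟩
      simp [hrel, mul_assoc]
    · cases hg with
      | base e _ h' =>
        exact .inl (zpow_mul_mul_zpow_mem_shortDigitSet a t (by omega) (by omega))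
      | @step c' L m' n g hg h' =>
      obtain ⟨i, q', r, hi, hcq, hqr, hr⟩ := exists_nonadjacent_digit ⟨q, hc⟩ c'
      refine .inr ⟨i, by rw [Finset.mem_Icc]; omega, by omega, a ^ r * g,
        ⟨L, (hg.zpow_mul r).mono (by omega)⟩, ?_⟩
      calc a ^ c * t * (a ^ c' * t * g) = a ^ i * (a ^ (2 * q') * t) * (a ^ c' * t * g) := by
            rw [hcq, zpow_add]; group
        _ = a ^ i * t * (a ^ (q' + c') * t) * g := by rw [hrel, zpow_add]; group
        _ = a ^ i * t ^ (i.natAbs + 1) * (a ^ r * g) := by rw [hqr, hrel, hi, pow_two]; group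
  · rwa [sum_Icc_neg_one_one_pow]

end GroupGrowth

/-! ### Affine actions -/

/-- The element `π` of the subring `O` behaves like a uniformizer with residue characteristic `p`:
an integer that is divisible by `π` in `O` is divisible by `p`. -/
structure IsDigitBase {K : Type*} [Field K] (p : ℕ) (O : Subring K) (π : K) : Prop where
  mem : π ∈ O
  ne_zero : π ≠ 0
  ne_one : p ≠ 1
  dvd : ∀ c : ℤ, ∀ w ∈ O, (c : K) = π * w → (p : ℤ) ∣ c

/-- The ball `c + π ^ n * O`. The exponent `n` may be negative. -/
def adicBall {K : Type*} [Field K] (O : Subring K) (π : K) (n : ℤ) (c : K) : Set K :=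
  {u | ∃ w ∈ O, u = c + π ^ n * w}

/-- The elements of the form `π ^ e * (c + π * w)` with `e ∈ E` and `w ∈ O`, that is, with leading
exponent in `E` and leading coefficient `c`. -/
def leadingSet {K : Type*} [Field K] (O : Subring K) (π : K) (E : Set ℤ) (c : ℤ) : Set K :=
  ⋃ e ∈ E, adicBall O π (e + 1) (c * π ^ e)

namespace IsDigitBase

variable {K : Type*} [Field K] {p : ℕ} {O : Subring K} {π : K}

theorem zpow_mem (hb : IsDigitBase p O π) {n : ℤ} (hn : 0 ≤ n) : π ^ n ∈ O := by
  lift n to ℕ using hn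
  simpa using pow_mem hb.mem n

theorem not_dvd_one (hb : IsDigitBase p O π) : ¬ (p : ℤ) ∣ 1 := by
  simpa [Int.natCast_dvd] using hb.ne_one

theorem eq_zero_of_zpow_eq_one (hb : IsDigitBase p O π) {n : ℤ} (h : π ^ n = 1) : n = 0 := by
  have not_pos : ∀ n : ℤ, 0 < n → π ^ n ≠ 1 := fun n hn h ↦ hb.not_dvd_one <|
    hb.dvd 1 (π ^ (n - 1)) (hb.zpow_mem (by omega)) <| by
      rw [← zpow_one_add₀ hb.ne_zero, add_sub_cancel, h, Int.cast_one]
  rcases lt_trichotomy n 0 with hn | hn | hn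
  · exact absurd (by rw [zpow_neg, h, inv_one]) (not_pos (-n) (by omega))
  · exact hn
  · exact absurd h (not_pos n hn)

theorem dvd_of_mem_adicBall (hb : IsDigitBase p O π) {n : ℤ} (hn : 0 < n) {c c' : ℤ}
    (h : (c : K) ∈ adicBall O π n c') : (p : ℤ) ∣ c - c' := by
  obtain ⟨w, hw, h⟩ := h
  refine hb.dvd _ (π ^ (n - 1) * w) (mul_mem (hb.zpow_mem (by omega)) hw) ?_
  rw [← mul_assoc, ← zpow_one_add₀ hb.ne_zero, add_sub_cancel, Int.cast_sub, h, add_sub_cancel_left]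

theorem adicBall_subset (hb : IsDigitBase p O π) {m n : ℤ} (hmn : m ≤ n) {c c' : K}
    (hc : c ∈ adicBall O π m c') : adicBall O π n c ⊆ adicBall O π m c' := by
  rintro _ ⟨w, hw, rfl⟩
  obtain ⟨v, hv, rfl⟩ := hc
  refine ⟨v + π ^ (n - m) * w, add_mem hv (mul_mem (hb.zpow_mem (by omega)) hw), ?_⟩
  rw [mul_add, ← mul_assoc, ← zpow_add₀ hb.ne_zero, add_sub_cancel, add_assoc]

theorem disjoint_adicBall (hb : IsDigitBase p O π) {m n : ℤ} {c c' : K}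
    (h : c ∉ adicBall O π (min m n) c') : Disjoint (adicBall O π m c) (adicBall O π n c') := by
  refine Set.disjoint_left.mpr ?_
  rintro u ⟨w, hw, rfl⟩ hu
  obtain ⟨v, hv, he⟩ := hb.adicBall_subset (min_le_right m n)
    (⟨0, O.zero_mem, by simp⟩ : c' ∈ adicBall O π _ c') hu
  refine h ⟨v - π ^ (m - min m n) * w, sub_mem hv (mul_mem (hb.zpow_mem (by omega)) hw), ?_⟩
  rw [mul_sub, ← mul_assoc, ← zpow_add₀ hb.ne_zero, add_sub_cancel]
  linear_combination he

theorem disjoint_adicBall_of_leading (hb : IsDigitBase p O π) {e e' c c' : ℤ}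
    (hc : ¬ (p : ℤ) ∣ c) (hc' : ¬ (p : ℤ) ∣ c') (h : e ≠ e' ∨ ¬ (p : ℤ) ∣ c - c') :
    Disjoint (adicBall O π (e + 1) (c * π ^ e)) (adicBall O π (e' + 1) (c' * π ^ e')) := by
  wlog hle : e ≤ e' generalizing e e' c c'
  · exact (this hc' hc (h.imp Ne.symm fun h ↦ by rwa [dvd_sub_comm]) (by omega)).symm
  refine hb.disjoint_adicBall fun ⟨w, hw, he⟩ ↦ ?_
  have hcancel : (c : K) = c' * π ^ (e' - e) + π * w := by
    refine mul_right_cancel₀ (zpow_ne_zero e hb.ne_zero) (he.trans ?_)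
    rw [min_eq_left (by omega), zpow_add₀ hb.ne_zero, zpow_sub₀ hb.ne_zero, zpow_one]
    have := zpow_ne_zero e hb.ne_zero
    field_simp
  rcases hle.eq_or_lt with rfl | hlt
  · refine (h.resolve_left fun h ↦ h rfl) (hb.dvd _ w hw ?_)
    rw [Int.cast_sub, hcancel, sub_self, zpow_zero]
    ring
  · refine hc (hb.dvd c (c' * π ^ (e' - e - 1) + w) (add_mem (mul_mem (intCast_mem O c')
      (hb.zpow_mem (by omega))) hw) ?_)
    have hsplit : π ^ (e' - e) = π * π ^ (e' - e - 1) := by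
      rw [← zpow_one_add₀ hb.ne_zero, add_sub_cancel]
    rw [hcancel, hsplit]
    ring

theorem disjoint_leadingSet (hb : IsDigitBase p O π) {E E' : Set ℤ} {c c' : ℤ}
    (hc : ¬ (p : ℤ) ∣ c) (hc' : ¬ (p : ℤ) ∣ c') (h : Disjoint E E' ∨ ¬ (p : ℤ) ∣ c - c') :
    Disjoint (leadingSet O π E c) (leadingSet O π E' c') := by
  refine Set.disjoint_iUnion₂_left.mpr fun e he ↦ Set.disjoint_iUnion₂_right.mpr fun e' he' ↦ ?_
  exact hb.disjoint_adicBall_of_leading hc hc' (h.imp_left fun h ↦ h.ne_of_mem he he')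

theorem leadingSet_subset (hb : IsDigitBase p O π) {E : Set ℤ} {n : ℤ} (h : ∀ e ∈ E, n ≤ e)
    (c : ℤ) : leadingSet O π E c ⊆ adicBall O π n 0 := by
  refine Set.iUnion₂_subset fun e he ↦ hb.adicBall_subset (by have := h e he; omega) ?_
  refine ⟨c * π ^ (e - n), mul_mem (intCast_mem O c) (hb.zpow_mem (by have := h e he; omega)), ?_⟩
  rw [zero_add, mul_left_comm, ← zpow_add₀ hb.ne_zero, add_sub_cancel]

end IsDigitBase

theorem adicBall_zero_nonempty {K : Type*} [Field K] (O : Subring K) (π : K) (n : ℤ) :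
    (adicBall O π n 0).Nonempty :=
  ⟨0, 0, O.zero_mem, by simp⟩

namespace GroupGrowth

variable {G K : Type*} [Group G] [Field K]

/-- Under the action `φ` on the field `K`, the element `g` is the affine map
`u ↦ π ^ h * u + c`. -/
def ActsAffinely (φ : G →* Equiv.Perm K) (π : K) (g : G) (h : ℤ) (c : K) : Prop :=
  ∀ u, φ g u = π ^ h * u + c

namespace ActsAffinely

variable {φ : G →* Equiv.Perm K} {π : K} {g g' : G} {h h' : ℤ} {c c' : K}

theorem one : ActsAffinely φ π 1 0 0 := fun u ↦ by simp

theorem mul (hπ : π ≠ 0) (hg : ActsAffinely φ π g h c) (hg' : ActsAffinely φ π g' h' c') :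
    ActsAffinely φ π (g * g') (h + h') (π ^ h * c' + c) := fun u ↦ by
  rw [map_mul, Equiv.Perm.mul_apply, hg', hg, zpow_add₀ hπ]
  ring

theorem inv (hπ : π ≠ 0) (hg : ActsAffinely φ π g h c) :
    ActsAffinely φ π g⁻¹ (-h) (-(π ^ (-h) * c)) := fun u ↦ by
  have := zpow_ne_zero h hπ
  rw [map_inv, Equiv.Perm.inv_eq_iff_eq, hg, zpow_neg]
  field_simp
  ring

theorem zpow_of_scaling (hπ : π ≠ 0) (hg : ActsAffinely φ π g h 0) (i : ℤ) :
    ActsAffinely φ π (g ^ i) (i * h) 0 := by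
  have hnat (n : ℕ) : ActsAffinely φ π (g ^ n) (n * h) 0 := by
    induction n with
    | zero => simpa using one
    | succ n ih =>
      rw [pow_succ, Nat.cast_succ, add_one_mul]
      simpa only [mul_zero, add_zero] using ih.mul hπ hg
  obtain ⟨n, rfl | rfl⟩ := i.eq_nat_or_neg
  · simpa using hnat n
  · simpa using (hnat n).inv hπ

theorem zpow_of_translation (hπ : π ≠ 0) (hg : ActsAffinely φ π g 0 c) (i : ℤ) :
    ActsAffinely φ π (g ^ i) 0 (i * c) := by
  have hnat (n : ℕ) : ActsAffinely φ π (g ^ n) 0 (n * c) := by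
    induction n with
    | zero => simpa using one
    | succ n ih =>
      rw [pow_succ', Nat.cast_succ, add_one_mul]
      simpa only [zpow_zero, one_mul, add_zero] using hg.mul hπ ih
  obtain ⟨n, rfl | rfl⟩ := i.eq_nat_or_neg
  · simpa using hnat n
  · simpa using (hnat n).inv hπ

theorem mapsTo_adicBall (hπ : π ≠ 0) (hg : ActsAffinely φ π g h c) (O : Subring K) (n : ℤ)
    (b : K) : Set.MapsTo (φ g) (adicBall O π n b) (adicBall O π (h + n) (π ^ h * b + c)) := by
  rintro _ ⟨w, hw, rfl⟩
  refine ⟨w, hw, ?_⟩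
  rw [hg, zpow_add₀ hπ]
  ring

theorem exists_normalForm {p : ℕ} {O : Subring K} (hb : IsDigitBase p O π) (hh : h ≠ 0)
    (hg : ActsAffinely φ π g h c) (hg' : ActsAffinely φ π g' h' c')
    (hne : ¬ Commute (φ g) (φ g')) :
    ∃ ψ : G →* Equiv.Perm K, ActsAffinely ψ π g h 0 ∧ ActsAffinely ψ π g' h' 1 := by
  have hone : 1 - π ^ h ≠ 0 := fun h0 ↦ hh (hb.eq_zero_of_zpow_eq_one (sub_eq_zero.mp h0).symm)
  obtain ⟨f, hf⟩ : ∃ f, π ^ h * f + c = f :=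
    ⟨c / (1 - π ^ h), by linear_combination -div_mul_cancel₀ c hone⟩
  obtain ⟨b, hb'⟩ : ∃ b, π ^ h' * f + c' = f + b := ⟨_, (add_sub_cancel _ _).symm⟩
  have hb0 : b ≠ 0 := by
    rintro rfl
    refine hne (Equiv.ext fun u ↦ ?_)
    rw [Equiv.Perm.mul_apply, Equiv.Perm.mul_apply, hg, hg', hg, hg']
    linear_combination (π ^ h - 1) * hb' + (1 - π ^ h') * hf
  let θ : Equiv.Perm K := (Equiv.mulLeft₀ b hb0).trans (Equiv.addLeft f)
  have hconj (k : G) {u v : K} (huv : φ k (f + b * u) = f + b * v) :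
      (MulAut.conj θ⁻¹).toMonoidHom.comp φ k u = v := by
    simp only [MonoidHom.comp_apply, MulEquiv.coe_toMonoidHom, MulAut.conj_apply, inv_inv,
      Equiv.Perm.mul_apply]
    exact Equiv.Perm.inv_eq_iff_eq.mpr huv
  refine ⟨(MulAut.conj θ⁻¹).toMonoidHom.comp φ, fun u ↦ hconj _ ?_, fun u ↦ hconj _ ?_⟩
  · rw [hg]
    linear_combination hf
  · rw [hg']
    linear_combination hb'

end ActsAffinely

section PingPong

variable {φ : G →* Equiv.Perm K} {p : ℕ} {O : Subring K} {π : K} {ι : Type*} {w : ι → G} {h : ι → ℤ}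

theorem isPingPong_of_actsAffinely (hb : IsDigitBase p O π) {c : ι → ℤ}
    (hw : ∀ i, ActsAffinely φ π (w i) (h i) (c i)) (hh : ∀ i, 0 ≤ h i)
    (hc : ∀ i j, i ≠ j → (c i : K) ∉ adicBall O π (min (h i) (h j)) (c j)) :
    IsPingPong φ (adicBall O π 0 0) (adicBall O π 0 0) w := by
  have himage (i : ι) : Set.MapsTo (φ (w i)) (adicBall O π 0 0) (adicBall O π (h i) (c i)) := by
    simpa using (hw i).mapsTo_adicBall hb.ne_zero O 0 0
  refine ⟨fun i ↦ (himage i).mono_right (hb.adicBall_subset (hh i) ?_), fun i j hij ↦ ?_⟩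
  · exact ⟨c i, intCast_mem O _, by simp⟩
  · exact (hb.disjoint_adicBall (hc i j hij)).mono (himage i).image_subset (himage j).image_subset

theorem isPingPong_leadingSet (hb : IsDigitBase p O π) {n : ℤ} {b : ι → K} {e : ι → ℤ} {c : ℤ}
    (hw : ∀ i, ActsAffinely φ π (w i) (h i) (b i))
    (hlead : ∀ i, b i ∈ adicBall O π (e i + 1) (c * π ^ e i)) (hn : ∀ i, e i + 1 ≤ h i + n)
    (he : e.Injective) (hc : ¬ (p : ℤ) ∣ c) :
    IsPingPong φ (adicBall O π n 0) (leadingSet O π (Set.range e) c) w := by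
  have himage (i : ι) : Set.MapsTo (φ (w i)) (adicBall O π n 0)
      (adicBall O π (e i + 1) (c * π ^ e i)) := by
    refine ((hw i).mapsTo_adicBall hb.ne_zero O n 0).mono_right (hb.adicBall_subset (hn i) ?_)
    simpa using hlead i
  refine ⟨fun i ↦ (himage i).mono_right ?_, fun i j hij ↦ ?_⟩
  · exact Set.subset_biUnion_of_mem (u := fun e ↦ adicBall O π (e + 1) (c * π ^ e))
      (Set.mem_range_self i)
  · exact (hb.disjoint_adicBall_of_leading hc hc (.inl (he.ne hij))).mono (himage i).image_subset
      (himage j).image_subset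

end PingPong

/-- Two elements `x` and `y` that are, up to inversion, in the generating set `S` and act on the
field `K` by `u ↦ π ^ h₁ * u` and `u ↦ π ^ h₂ * u + 1`. Any two non-commuting affine maps, one of
which is not a translation, take this form after conjugation and inversion. -/
structure NormalizedPair (φ : G →* Equiv.Perm K) (π : K) (S : Set G) (x y : G) (h₁ h₂ : ℤ) :
    Prop where
  x_mem : x ∈ ball S 1
  y_mem : y ∈ ball S 1
  pos : 0 < h₁
  x_acts : ActsAffinely φ π x h₁ 0
  y_acts : ActsAffinely φ π y h₂ 1

/-- The group generated by `a` and `t` acts on the field `K` such that `a` is the translation by `1`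
and `t` the multiplication by `π`. Both the lamplighter groups and the Baumslag–Solitar groups are
of this form. -/
structure IsAffineModel (p : ℕ) (O : Subring K) (π : K) (φ : G →* Equiv.Perm K) (a t : G) :
    Prop extends IsDigitBase p O π where
  closure_eq_top : Subgroup.closure {a, t} = ⊤
  a_acts : ActsAffinely φ π a 0 1
  t_acts : ActsAffinely φ π t 1 0

namespace IsAffineModel

variable {p : ℕ} {O : Subring K} {π : K} {φ : G →* Equiv.Perm K} {a t : G} {S : Set G}

theorem isFiniteGeneratingSet (hM : IsAffineModel p O π φ a t) :
    IsFiniteGeneratingSet ({a, t} : Set G) :=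
  ⟨by simp, hM.closure_eq_top⟩

theorem exists_actsAffinely (hM : IsAffineModel p O π φ a t) (g : G) :
    ∃ h c, ActsAffinely φ π g h c := by
  have hg : g ∈ Subgroup.closure {a, t} := hM.closure_eq_top ▸ Subgroup.mem_top g
  induction hg using Subgroup.closure_induction with
  | mem s hs =>
    rcases hs with rfl | rfl
    exacts [⟨0, 1, hM.a_acts⟩, ⟨1, 0, hM.t_acts⟩]
  | one => exact ⟨0, 0, .one⟩
  | mul g g' _ _ hg hg' =>
    obtain ⟨_, _, hg⟩ := hg
    obtain ⟨_, _, hg'⟩ := hg'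
    exact ⟨_, _, hg.mul hM.ne_zero hg'⟩
  | inv g _ hg =>
    obtain ⟨_, _, hg⟩ := hg
    exact ⟨_, _, hg.inv hM.ne_zero⟩

theorem exists_scaling_mem (hM : IsAffineModel p O π φ a t) (hS : Subgroup.closure S = ⊤) :
    ∃ x ∈ S, ∃ h c, h ≠ 0 ∧ ActsAffinely φ π x h c := by
  by_contra! htranslations
  have hall (g : G) : ∃ c, ActsAffinely φ π g 0 c := by
    have hg : g ∈ Subgroup.closure S := hS ▸ Subgroup.mem_top g
    induction hg using Subgroup.closure_induction with
    | mem s hs =>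
      obtain ⟨h, c, hsc⟩ := hM.exists_actsAffinely s
      obtain rfl : h = 0 := by
        by_contra h0
        exact htranslations s hs h c h0 hsc
      exact ⟨c, hsc⟩
    | one => exact ⟨0, .one⟩
    | mul g g' _ _ hg hg' =>
      obtain ⟨_, hg⟩ := hg
      obtain ⟨_, hg'⟩ := hg'
      exact ⟨_, by simpa using hg.mul hM.ne_zero hg'⟩
    | inv g _ hg =>
      obtain ⟨_, hg⟩ := hg
      exact ⟨_, by simpa using hg.inv hM.ne_zero⟩
  obtain ⟨c, hc⟩ := hall t
  have hc₀ : φ t 0 = c := by simpa using hc 0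
  have hc₁ : φ t 1 = 1 + c := by simpa using hc 1
  rw [hM.t_acts] at hc₀ hc₁
  exact one_ne_zero (hM.eq_zero_of_zpow_eq_one (n := 1) (by linear_combination hc₁ - hc₀))

theorem exists_not_commute (hM : IsAffineModel p O π φ a t) (hS : Subgroup.closure S = ⊤) {x : G}
    {h : ℤ} {c : K} (hh : h ≠ 0) (hx : ActsAffinely φ π x h c) :
    ∃ y ∈ S, ¬ Commute (φ x) (φ y) := by
  by_contra! hcomm
  have hle : Subgroup.closure S ≤ (Subgroup.centralizer {φ x}).comap φ :=
    (Subgroup.closure_le _).mpr fun y hy ↦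
      Subgroup.mem_centralizer_singleton_iff.mpr (hcomm y hy).symm
  have ha : φ x * φ a = φ a * φ x :=
    (Subgroup.mem_centralizer_singleton_iff.mp (hle (hS ▸ Subgroup.mem_top a))).symm
  have ha₀ := DFunLike.congr_fun ha 0
  rw [Equiv.Perm.mul_apply, Equiv.Perm.mul_apply, hM.a_acts, hx, hx, hM.a_acts, zpow_zero] at ha₀
  exact hh (hM.eq_zero_of_zpow_eq_one (by linear_combination ha₀))

theorem exists_normalizedPair (hM : IsAffineModel p O π φ a t) (hS : Subgroup.closure S = ⊤) :
    ∃ (ψ : G →* Equiv.Perm K) (x y : G) (h₁ h₂ : ℤ), NormalizedPair ψ π S x y h₁ h₂ ∧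
      (h₂ = 0 ∨ h₁ ≤ h₂) := by
  obtain ⟨x, hxS, h₁, c₁, hh₁, hx⟩ : ∃ x ∈ ball S 1, ∃ h c, 0 < h ∧ ActsAffinely φ π x h c := by
    obtain ⟨x, hxS, h, c, hh, hx⟩ := hM.exists_scaling_mem hS
    rcases hh.lt_or_gt with hneg | hpos
    · exact ⟨x⁻¹, inv_mem_ball (subset_ball_one S hxS), _, _, by omega, hx.inv hM.ne_zero⟩
    · exact ⟨x, subset_ball_one S hxS, h, c, hpos, hx⟩
  obtain ⟨y, hyS, h₂, c₂, hh₂, hy, hxy⟩ :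
      ∃ y ∈ ball S 1, ∃ h c, 0 ≤ h ∧ ActsAffinely φ π y h c ∧ ¬ Commute (φ x) (φ y) := by
    obtain ⟨y, hyS, hxy⟩ := hM.exists_not_commute hS hh₁.ne' hx
    obtain ⟨h, c, hy⟩ := hM.exists_actsAffinely y
    rcases lt_or_ge h 0 with hneg | hnonneg
    · refine ⟨y⁻¹, inv_mem_ball (subset_ball_one S hyS), _, _, by omega, hy.inv hM.ne_zero, ?_⟩
      rwa [map_inv, Commute.inv_right_iff]
    · exact ⟨y, subset_ball_one S hyS, h, c, hnonneg, hy, hxy⟩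
  by_cases hle : h₂ = 0 ∨ h₁ ≤ h₂
  · obtain ⟨ψ, hx, hy⟩ := hx.exists_normalForm hM.toIsDigitBase hh₁.ne' hy hxy
    exact ⟨ψ, x, y, h₁, h₂, ⟨hxS, hyS, hh₁, hx, hy⟩, hle⟩
  · obtain ⟨ψ, hy, hx⟩ := hy.exists_normalForm hM.toIsDigitBase (by omega) hx fun h ↦ hxy h.symm
    exact ⟨ψ, y, x, h₂, h₁, ⟨hyS, hxS, by omega, hy, hx⟩, .inr (by omega)⟩

end IsAffineModel

end GroupGrowth

/-! ### Ping-pong for normalized pairs -/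

namespace GroupGrowth

theorem hasSum_pow_add {r : ℝ} (hr : 0 ≤ r) (hr₁ : r < 1) (m : ℕ) :
    HasSum (fun i ↦ r ^ (i + m)) (r ^ m / (1 - r)) := by
  simpa only [pow_add, div_eq_inv_mul] using (hasSum_geometric_of_lt_one hr hr₁).mul_right (r ^ m)

theorem hasSum_pow_add_add {r : ℝ} (hr : 0 ≤ r) (hr₁ : r < 1) (m n : ℕ) :
    HasSum (fun q : ℕ × ℕ ↦ r ^ (q.1 + m + (q.2 + n))) (r ^ m / (1 - r) * (r ^ n / (1 - r))) := by
  have hm := hasSum_pow_add hr hr₁ m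
  have hn := hasSum_pow_add hr hr₁ n
  simpa only [pow_add r (_ + m)] using hm.mul hn (hm.summable.mul_of_nonneg hn.summable
    (fun _ ↦ by positivity) fun _ ↦ by positivity)

section Residues

variable {G K ι : Type*} [Group G] [Field K] {φ : G →* Equiv.Perm K} {p : ℕ} {O : Subring K} {π : K}
  {S : Set G}

theorem inv_le_growthRate_of_residues (hb : IsDigitBase p O π) (hS : S.Finite) {s : Finset ι}
    {w : ι → G} {h c : ι → ℤ} {ℓ : ι → ℕ} (hw : ∀ i, ActsAffinely φ π (w i) (h i) (c i : ℤ))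
    (hh : ∀ i, 0 < h i) (hc : ∀ i ∈ s, ∀ j ∈ s, (p : ℤ) ∣ c i - c j → i = j)
    (hwS : ∀ i, w i ∈ ball S (ℓ i)) (hℓ : ∀ i, 1 ≤ ℓ i) {r : ℝ} (hr : 0 < r)
    (hsum : 1 ≤ ∑ i ∈ s, r ^ ℓ i) : r⁻¹ ≤ growthRate S := by
  have hpp : IsPingPong φ (adicBall O π 0 0) (adicBall O π 0 0) fun i : s ↦ w i := by
    refine isPingPong_of_actsAffinely hb (fun i ↦ hw i) (fun i ↦ (hh i).le) fun i j hij hmem ↦ ?_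
    exact hij (Subtype.ext (hc i i.2 j j.2
      (hb.dvd_of_mem_adicBall (lt_min (hh i) (hh j)) hmem)))
  refine hpp.inv_le_growthRate (adicBall_zero_nonempty O π 0) hS (s := Finset.univ)
    (fun i ↦ hwS i) (fun i ↦ hℓ i) hr ?_
  rwa [Finset.sum_coe_sort s fun i ↦ r ^ ℓ i]

end Residues

namespace NormalizedPair

variable {G K : Type*} [Group G] [Field K] {φ : G →* Equiv.Perm K} {p : ℕ} {O : Subring K} {π : K}
  {S : Set G} {x y : G} {h₁ h₂ : ℤ} {r : ℝ}

theorem zpow_x_acts (hN : NormalizedPair φ π S x y h₁ h₂) (hπ : π ≠ 0) (i : ℤ) :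
    ActsAffinely φ π (x ^ i) (i * h₁) 0 :=
  hN.x_acts.zpow_of_scaling hπ i

theorem zpow_mul_acts (hN : NormalizedPair φ π S x y h₁ h₂) (hπ : π ≠ 0) (i : ℤ) :
    ActsAffinely φ π (x ^ i * y) (i * h₁ + h₂) (π ^ (i * h₁)) := by
  simpa using (hN.zpow_x_acts hπ i).mul hπ hN.y_acts

theorem zpow_mul_inv_acts (hN : NormalizedPair φ π S x y h₁ h₂) (hπ : π ≠ 0) (i : ℤ) :
    ActsAffinely φ π (x ^ i * y⁻¹) (i * h₁ - h₂) (-π ^ (i * h₁ - h₂)) := by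
  have h := (hN.zpow_x_acts hπ i).mul hπ (hN.y_acts.inv hπ)
  rwa [mul_one, add_zero, mul_neg, ← zpow_add₀ hπ, ← sub_eq_add_neg] at h

theorem zpow_x_mem (hN : NormalizedPair φ π S x y h₁ h₂) (i : ℤ) : x ^ i ∈ ball S i.natAbs := by
  simpa using zpow_mem_ball hN.x_mem i

theorem zpow_mul_mem (hN : NormalizedPair φ π S x y h₁ h₂) (i : ℤ) :
    x ^ i * y ∈ ball S (i.natAbs + 1) :=
  mul_mem_ball (hN.zpow_x_mem i) hN.y_mem

theorem zpow_mul_inv_mem (hN : NormalizedPair φ π S x y h₁ h₂) (i : ℤ) :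
    x ^ i * y⁻¹ ∈ ball S (i.natAbs + 1) :=
  mul_mem_ball (hN.zpow_x_mem i) (inv_mem_ball hN.y_mem)

theorem two_le_growthRate (hN : NormalizedPair φ π S x y h₁ h₂) (hb : IsDigitBase p O π)
    (hS : S.Finite) (hh₂ : 0 < h₂) : 2 ≤ growthRate S := by
  have hone := hb.not_dvd_one
  rw [← inv_inv (2 : ℝ)]
  refine inv_le_growthRate_of_residues hb hS (s := Finset.univ) (w := fun b ↦ cond b y x)
    (h := fun b ↦ cond b h₂ h₁) (c := fun b ↦ cond b 1 0) (ℓ := fun _ ↦ 1) ?_ ?_ ?_ ?_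
    (fun _ ↦ le_rfl) (φ := φ) (by norm_num) (by norm_num)
  · rintro (_ | _)
    exacts [by simpa using hN.x_acts, by simpa using hN.y_acts]
  · rintro (_ | _)
    exacts [hN.pos, hh₂]
  · rintro (_ | _) - (_ | _) - <;> simp [hone]
  · rintro (_ | _)
    exacts [hN.x_mem, hN.y_mem]

section Translation

theorem zpow_mul_pow_acts (hN : NormalizedPair φ π S x y h₁ 0) (hπ : π ≠ 0) (i : ℤ) (n : ℕ) :
    ActsAffinely φ π (y ^ i * x ^ n) (n * h₁) i := by
  simpa using (hN.y_acts.zpow_of_translation hπ i).mul hπ (hN.zpow_x_acts hπ n)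

theorem zpow_mul_pow_mem (hN : NormalizedPair φ π S x y h₁ h₂) (i : ℤ) (n : ℕ) :
    y ^ i * x ^ n ∈ ball S (i.natAbs + n) := by
  simpa using mul_mem_ball (zpow_mem_ball hN.y_mem i) (pow_mem_ball hN.x_mem n)

theorem inv_le_growthRate_of_digits (hN : NormalizedPair φ π S x y h₁ 0) (hb : IsDigitBase p O π)
    (hS : S.Finite) {s : Finset ℤ} (hs : ∀ i ∈ s, ∀ j ∈ s, (p : ℤ) ∣ i - j → i = j) (hr : 0 < r)
    (hsum : 1 ≤ ∑ i ∈ s, r ^ (i.natAbs + 1)) : r⁻¹ ≤ growthRate S := by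
  refine inv_le_growthRate_of_residues hb hS (c := id) (fun i ↦ hN.zpow_mul_pow_acts hb.ne_zero i 1)
    (fun _ ↦ by simpa using hN.pos) hs (fun i ↦ hN.zpow_mul_pow_mem i 1) (by simp) hr hsum

theorem inv_le_growthRate_of_nonadjacent (hN : NormalizedPair φ π S x y h₁ 0)
    (hb : IsDigitBase p O π) (hS : S.Finite) (htwo : (2 : K) ∉ adicBall O π 2 0) (hr : 0 < r)
    (hsum : 1 ≤ r + 2 * r ^ 3) : r⁻¹ ≤ growthRate S := by
  have hpos := hN.pos
  have hpp : IsPingPong φ (adicBall O π 0 0) (adicBall O π 0 0)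
      fun i : Finset.Icc (-1 : ℤ) 1 ↦ y ^ (i : ℤ) * x ^ ((i : ℤ).natAbs + 1) := by
    refine isPingPong_of_actsAffinely hb (fun i ↦ hN.zpow_mul_pow_acts hb.ne_zero i _)
      (fun i ↦ by positivity) ?_
    rintro ⟨i, hi⟩ ⟨j, hj⟩ hij hmem
    rw [Finset.mem_Icc] at hi hj
    have hne : i ≠ j := fun h ↦ hij (Subtype.ext h)
    have hndvd : ¬ (i - j).natAbs = 1 := fun h ↦ hb.not_dvd_one <| by
      simpa [Int.natCast_dvd, h] using hb.dvd_of_mem_adicBall (by positivity) hmem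
    obtain ⟨hi₁, hj₁⟩ : i.natAbs = 1 ∧ j.natAbs = 1 := by omega
    obtain ⟨w, hw, hwij⟩ := hmem
    have hmin : π ^ min (((i.natAbs + 1 : ℕ) : ℤ) * h₁) ((j.natAbs + 1 : ℕ) * h₁) =
        π ^ (2 : ℤ) * π ^ (2 * h₁ - 2) := by
      rw [hi₁, hj₁, min_self, ← zpow_add₀ hb.ne_zero, add_sub_cancel]
      norm_num
    have hmem : π ^ (2 * h₁ - 2) * w ∈ O := mul_mem (hb.zpow_mem (by omega)) hw
    rw [hmin, mul_assoc] at hwij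
    rcases (by omega : i = 1 ∧ j = -1 ∨ i = -1 ∧ j = 1) with ⟨rfl, rfl⟩ | ⟨rfl, rfl⟩
    · refine htwo ⟨_, hmem, ?_⟩
      push_cast at hwij
      linear_combination hwij
    · refine htwo ⟨_, neg_mem hmem, ?_⟩
      push_cast at hwij
      linear_combination -hwij
  refine hpp.inv_le_growthRate (adicBall_zero_nonempty O π 0) hS (s := Finset.univ)
    (ℓ := fun i ↦ 2 * (i : ℤ).natAbs + 1)
    (fun i ↦ ball_mono S (by omega) (hN.zpow_mul_pow_mem i _)) (fun i ↦ by omega) hr ?_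
  rwa [Finset.sum_coe_sort (Finset.Icc (-1 : ℤ) 1) fun i ↦ r ^ (2 * i.natAbs + 1),
    sum_Icc_neg_one_one_pow]

end Translation

section EqualScaling

theorem zpow_mul_inv_mul_acts (hN : NormalizedPair φ π S x y h₁ h₁) (hπ : π ≠ 0) (i : ℤ) :
    ActsAffinely φ π ((y * x⁻¹) ^ i * x) h₁ i := by
  have hyx : ActsAffinely φ π (y * x⁻¹) 0 1 := by
    simpa using hN.y_acts.mul hπ (hN.x_acts.inv hπ)
  simpa using (hyx.zpow_of_translation hπ i).mul hπ hN.x_acts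

theorem zpow_mul_inv_mul_mem (hN : NormalizedPair φ π S x y h₁ h₂) (i : ℤ) :
    (y * x⁻¹) ^ i * x ∈ ball S (2 * i - 1).natAbs := by
  have hyx : y * x⁻¹ ∈ ball S 2 := mul_mem_ball hN.y_mem (inv_mem_ball hN.x_mem)
  rcases lt_or_ge 0 i with hi | hi
  · have hsplit : (y * x⁻¹) ^ i * x = (y * x⁻¹) ^ (i - 1) * y := by
      rw [zpow_sub_one, mul_inv_rev, inv_inv]
      group
    rw [hsplit]
    exact ball_mono S (by omega) (mul_mem_ball (zpow_mem_ball hyx (i - 1)) hN.y_mem)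
  · exact ball_mono S (by omega) (mul_mem_ball (zpow_mem_ball hyx i) hN.x_mem)

theorem inv_le_growthRate_of_digits_of_eq (hN : NormalizedPair φ π S x y h₁ h₁)
    (hb : IsDigitBase p O π) (hS : S.Finite) {s : Finset ℤ}
    (hs : ∀ i ∈ s, ∀ j ∈ s, (p : ℤ) ∣ i - j → i = j) (hr : 0 < r)
    (hsum : 1 ≤ ∑ i ∈ s, r ^ (2 * i - 1).natAbs) :
    r⁻¹ ≤ growthRate S :=
  inv_le_growthRate_of_residues hb hS (c := id) (hN.zpow_mul_inv_mul_acts hb.ne_zero)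
    (fun _ ↦ hN.pos) hs hN.zpow_mul_inv_mul_mem (fun i ↦ by omega) hr hsum

end EqualScaling

section Hyperbolic

/-- The words `x ^ (i - a) * y` and `x ^ (i + 1) * y⁻¹ * (x ^ (j + 1) * y)`, which play ping-pong
when `y` scales by more than `x`. -/
def hyperbolicWord (x y : G) (a : ℕ) : ℕ ⊕ ℕ × ℕ → G :=
  Sum.elim (fun i ↦ x ^ ((i : ℤ) - a) * y)
    fun q ↦ x ^ ((q.1 : ℤ) + 1) * y⁻¹ * (x ^ ((q.2 : ℤ) + 1) * y)

/-- The length of `hyperbolicWord x y a` as a word in `x` and `y`. -/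
def hyperbolicLength (a : ℕ) : ℕ ⊕ ℕ × ℕ → ℕ :=
  Sum.elim (fun i ↦ ((i : ℤ) - a).natAbs + 1) fun q ↦ q.1 + 2 + (q.2 + 2)

/-- The set into which the words `hyperbolicWord x y a` map: the leading coefficient is `1` for the
words of the first kind and `-1` for those of the second. -/
def hyperbolicTarget (O : Subring K) (π : K) (h₁ h₂ : ℤ) (a : ℕ) : Set K :=
  leadingSet O π (Set.range fun i : ℕ ↦ ((i : ℤ) - a) * h₁) 1 ∪
    leadingSet O π (Set.range fun i : ℕ ↦ ((i : ℤ) + 1) * h₁ - h₂) (-1)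

theorem one_le_hyperbolicLength (a : ℕ) (i : ℕ ⊕ ℕ × ℕ) : 1 ≤ hyperbolicLength a i := by
  rcases i with i | ⟨i, j⟩ <;> simp only [hyperbolicLength, Sum.elim_inl, Sum.elim_inr] <;> omega

theorem hasSum_pow_hyperbolicLength (hr : 0 ≤ r) (hr₁ : r < 1) (a : ℕ) :
    HasSum (fun i ↦ r ^ hyperbolicLength a i)
      (r / (1 - r) + ∑ i ∈ Finset.range a, r ^ (a - i + 1) + (r ^ 2 / (1 - r)) ^ 2) := by
  rw [sq (r ^ 2 / _)]
  refine .sum ?_ (hasSum_pow_add_add hr hr₁ 2 2)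
  have hsum : ∑ i ∈ Finset.range a, r ^ (a - i + 1) =
      ∑ i ∈ Finset.range a, r ^ (((i : ℤ) - a).natAbs + 1) := by
    refine Finset.sum_congr rfl fun i hi ↦ ?_
    rw [Finset.mem_range] at hi
    congr 2
    omega
  rw [hsum]
  refine (hasSum_nat_add_iff a).mp ?_
  simpa [hyperbolicLength] using hasSum_pow_add hr hr₁ 1

variable {ι : Type*} {f : ι → ℤ}

theorem isPingPong_zpow_mul (hN : NormalizedPair φ π S x y h₁ h₂) (hb : IsDigitBase p O π)
    (hf : f.Injective) : IsPingPong φ (adicBall O π (1 - h₂) 0)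
      (leadingSet O π (Set.range fun i ↦ f i * h₁) 1) fun i ↦ x ^ f i * y :=
  isPingPong_leadingSet hb (fun i ↦ hN.zpow_mul_acts hb.ne_zero (f i))
    (fun _ ↦ ⟨0, O.zero_mem, by simp⟩) (fun _ ↦ by omega)
    ((mul_left_injective₀ hN.pos.ne').comp hf) hb.not_dvd_one

theorem isPingPong_zpow_mul_inv (hN : NormalizedPair φ π S x y h₁ h₂) (hb : IsDigitBase p O π)
    (hf : f.Injective) : IsPingPong φ (adicBall O π 1 0)
      (leadingSet O π (Set.range fun i ↦ f i * h₁ - h₂) (-1)) fun i ↦ x ^ f i * y⁻¹ :=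
  isPingPong_leadingSet hb (fun i ↦ hN.zpow_mul_inv_acts hb.ne_zero (f i))
    (fun _ ↦ ⟨0, O.zero_mem, by simp⟩) (fun _ ↦ le_rfl)
    ((sub_left_injective (b := h₂)).comp ((mul_left_injective₀ hN.pos.ne').comp hf))
    (by simpa using hb.not_dvd_one)

theorem isPingPong_zpow_mul_zpow_mul (hN : NormalizedPair φ π S x y h₁ h₂)
    (hb : IsDigitBase p O π) (hp₂ : ¬ (p : ℤ) ∣ 2) (hf : f.Injective) (hh₂ : 0 < h₂)
    (hle : h₂ ≤ 2 * h₁) : IsPingPong φ (adicBall O π 0 0)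
      (leadingSet O π (Set.range fun i ↦ f i * h₁ + (h₂ - 2 * h₁)) (if h₂ = 2 * h₁ then 2 else 1))
      fun i ↦ x ^ f i * y * (x ^ (-2 : ℤ) * y) := by
  refine isPingPong_leadingSet hb
    (fun i ↦ (hN.zpow_mul_acts hb.ne_zero (f i)).mul hb.ne_zero (hN.zpow_mul_acts hb.ne_zero (-2)))
    (fun i ↦ ?_) (fun _ ↦ by omega)
    ((add_left_injective (h₂ - 2 * h₁)).comp ((mul_left_injective₀ hN.pos.ne').comp hf)) ?_
  · set e := f i * h₁ + (h₂ - 2 * h₁)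
    have htranslation : π ^ (f i * h₁ + h₂) * π ^ (-2 * h₁) + π ^ (f i * h₁) =
        π ^ e * (1 + π ^ (2 * h₁ - h₂)) := by
      rw [mul_one_add, ← zpow_add₀ hb.ne_zero, ← zpow_add₀ hb.ne_zero]
      congr 2 <;> simp only [e] <;> ring
    rw [htranslation]
    split_ifs with heq
    · exact ⟨0, O.zero_mem, by rw [heq, sub_self, zpow_zero]; push_cast; ring⟩
    · refine ⟨π ^ (2 * h₁ - h₂ - 1), hb.zpow_mem (by omega), ?_⟩
      rw [← zpow_add₀ hb.ne_zero, mul_one_add, ← zpow_add₀ hb.ne_zero]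
      push_cast
      ring_nf
  · split_ifs
    exacts [hp₂, hb.not_dvd_one]

theorem isPingPong_hyperbolicWord (hN : NormalizedPair φ π S x y h₁ h₂) (hb : IsDigitBase p O π)
    (hp₂ : ¬ (p : ℤ) ∣ 2) (a : ℕ) :
    IsPingPong φ (adicBall O π (1 - h₂) 0) (hyperbolicTarget O π h₁ h₂ a)
      (hyperbolicWord x y a) := by
  have hpos := hN.pos
  have hsucc : Function.Injective fun i : ℕ ↦ (i : ℤ) + 1 := fun i j h ↦ by simpa using h
  refine (hN.isPingPong_zpow_mul hb fun i j h ↦ by simpa using h).sumElim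
    ((hN.isPingPong_zpow_mul_inv hb hsucc).mul
      ((hN.isPingPong_zpow_mul hb hsucc).mono (hb.leadingSet_subset ?_ 1)))
    (hb.disjoint_leadingSet hb.not_dvd_one (by simpa using hb.not_dvd_one) (.inr hp₂))
  rintro _ ⟨i, rfl⟩
  change 1 ≤ ((i : ℤ) + 1) * h₁
  nlinarith

theorem hyperbolicTarget_subset (hN : NormalizedPair φ π S x y h₁ h₂) (hb : IsDigitBase p O π)
    {a : ℕ} (ha : a * h₁ < h₂) : hyperbolicTarget O π h₁ h₂ a ⊆ adicBall O π (1 - h₂) 0 := by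
  have hpos := hN.pos
  refine Set.union_subset (hb.leadingSet_subset ?_ 1) (hb.leadingSet_subset ?_ (-1))
  · rintro _ ⟨i, rfl⟩
    change 1 - h₂ ≤ ((i : ℤ) - a) * h₁
    nlinarith
  · rintro _ ⟨i, rfl⟩
    change 1 - h₂ ≤ ((i : ℤ) + 1) * h₁ - h₂
    nlinarith

theorem hyperbolicWord_mem (hN : NormalizedPair φ π S x y h₁ h₂) (a : ℕ) (i : ℕ ⊕ ℕ × ℕ) :
    hyperbolicWord x y a i ∈ ball S (hyperbolicLength a i) := by
  rcases i with i | ⟨i, j⟩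
  · exact hN.zpow_mul_mem _
  · exact ball_mono S (by simp only [hyperbolicLength, Sum.elim_inr]; omega)
      (mul_mem_ball (hN.zpow_mul_inv_mem (i + 1)) (hN.zpow_mul_mem (j + 1)))

theorem inv_le_growthRate_of_two_mul_lt (hN : NormalizedPair φ π S x y h₁ h₂)
    (hb : IsDigitBase p O π) (hS : S.Finite) (hp₂ : ¬ (p : ℤ) ∣ 2) (hlt : 2 * h₁ < h₂)
    (hr : 0 < r) (hr₁ : r < 1) (hsum : 1 < r / (1 - r) + (r ^ 3 + r ^ 2) + (r ^ 2 / (1 - r)) ^ 2) :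
    r⁻¹ ≤ growthRate S := by
  have hpp := (hN.isPingPong_hyperbolicWord hb hp₂ 2).mono (hN.hyperbolicTarget_subset hb hlt)
  refine hpp.inv_le_growthRate_of_hasSum (adicBall_zero_nonempty O π _) hS
    (hN.hyperbolicWord_mem 2) (one_le_hyperbolicLength 2) hr
    (hasSum_pow_hyperbolicLength hr.le hr₁ 2) ?_
  simpa [Finset.sum_range_succ] using hsum

theorem isPingPong_pow_mul_zpow_mul_pow_mul (hN : NormalizedPair φ π S x y h₁ h₂)
    (hb : IsDigitBase p O π) (hp₂ : ¬ (p : ℤ) ∣ 2) (hh₂ : 0 < h₂) (hle : h₂ ≤ 2 * h₁) :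
    IsPingPong φ (adicBall O π (1 - h₂) 0)
      (leadingSet O π (Set.range fun i : ℕ ↦ i * h₁ + (h₂ - 2 * h₁))
        (if h₂ = 2 * h₁ then 2 else 1))
      fun q : ℕ × ℕ ↦ x ^ (q.1 : ℤ) * y * (x ^ (-2 : ℤ) * y) * (x ^ (q.2 : ℤ) * y) := by
  have hpos := hN.pos
  refine (hN.isPingPong_zpow_mul_zpow_mul hb hp₂ Nat.cast_injective hh₂ hle).mul
    ((hN.isPingPong_zpow_mul hb Nat.cast_injective).mono (hb.leadingSet_subset ?_ 1))
  rintro _ ⟨i, rfl⟩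
  positivity

theorem disjoint_hyperbolicTarget_leadingSet (hN : NormalizedPair φ π S x y h₁ h₂)
    (hb : IsDigitBase p O π) (hp₂ : ¬ (p : ℤ) ∣ 2) (hp₃ : ¬ (p : ℤ) ∣ 3) (hlt : h₁ < h₂)
    (hle : h₂ ≤ 2 * h₁) (a : ℕ) : Disjoint (hyperbolicTarget O π h₁ h₂ a)
      (leadingSet O π (Set.range fun i : ℕ ↦ i * h₁ + (h₂ - 2 * h₁))
        (if h₂ = 2 * h₁ then 2 else 1)) := by
  have hp₁ := hb.not_dvd_one
  have hp₁' : ¬ (p : ℤ) ∣ -1 := by simpa using hp₁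
  rw [hyperbolicTarget, Set.disjoint_union_left]
  split_ifs with heq
  · exact ⟨hb.disjoint_leadingSet hp₁ hp₂ (.inr (by simpa using hp₁)),
      hb.disjoint_leadingSet hp₁' hp₂ (.inr (by simpa using hp₃))⟩
  · refine ⟨hb.disjoint_leadingSet hp₁ hp₁ (.inl ?_),
      hb.disjoint_leadingSet hp₁' hp₁ (.inr (by simpa using hp₂))⟩
    rw [Set.disjoint_left]
    rintro _ ⟨i, rfl⟩ ⟨j, hij⟩
    have hm : h₂ = ((i : ℤ) - a - j + 2) * h₁ := by linear_combination hij
    have hm₁ : 1 < (i : ℤ) - a - j + 2 := by nlinarith [hN.pos, hm]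
    have hm₂ : (i : ℤ) - a - j + 2 < 2 := by nlinarith [hN.pos, hle.lt_of_ne heq, hm]
    omega

theorem inv_le_growthRate_of_le_two_mul (hN : NormalizedPair φ π S x y h₁ h₂)
    (hb : IsDigitBase p O π) (hS : S.Finite) (hp₂ : ¬ (p : ℤ) ∣ 2) (hp₃ : ¬ (p : ℤ) ∣ 3)
    (hlt : h₁ < h₂) (hle : h₂ ≤ 2 * h₁) (hr : 0 < r) (hr₁ : r < 1)
    (hsum : 1 < r / (1 - r) + r ^ 2 + (r ^ 2 / (1 - r)) ^ 2 + r ^ 5 / (1 - r) ^ 2) :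
    r⁻¹ ≤ growthRate S := by
  have hpos := hN.pos
  have hpp := ((hN.isPingPong_hyperbolicWord hb hp₂ 1).sumElim
    (hN.isPingPong_pow_mul_zpow_mul_pow_mul hb hp₂ (hpos.trans hlt) hle)
    (hN.disjoint_hyperbolicTarget_leadingSet hb hp₂ hp₃ hlt hle 1)).mono
    (Set.union_subset (hN.hyperbolicTarget_subset hb (by simpa using hlt)) (hb.leadingSet_subset
      (by rintro _ ⟨i, rfl⟩; change _ ≤ (i : ℤ) * h₁ + _; nlinarith) _))
  refine hpp.inv_le_growthRate_of_hasSum (adicBall_zero_nonempty O π _) hS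
    (ℓ := Sum.elim (hyperbolicLength 1) fun q ↦ q.1 + 4 + (q.2 + 1)) ?_ ?_ hr
    (.sum (hasSum_pow_hyperbolicLength hr.le hr₁ 1) (hasSum_pow_add_add hr.le hr₁ 4 1)) ?_
  · rintro (i | ⟨i, j⟩)
    · exact hN.hyperbolicWord_mem 1 i
    · exact ball_mono S (by simp only [Sum.elim_inr]; omega) (mul_mem_ball (mul_mem_ball
        (hN.zpow_mul_mem i) (hN.zpow_mul_mem (-2))) (hN.zpow_mul_mem j))
  · rintro (i | ⟨i, j⟩)
    exacts [one_le_hyperbolicLength 1 i, by simp only [Sum.elim_inr]; omega]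
  · have hone : 1 - r ≠ 0 := by linarith
    convert hsum using 2
    · simp
    · field_simp

end Hyperbolic

theorem inv_le_growthRate_of_lt (hN : NormalizedPair φ π S x y h₁ h₂) (hb : IsDigitBase p O π)
    (hS : S.Finite) (hp₂ : ¬ (p : ℤ) ∣ 2) (hp₃ : ¬ (p : ℤ) ∣ 3) (hlt : h₁ < h₂) (hr : 0 < r)
    (hr₁ : r < 1) (hr₂ : 1 < r ^ 2 + 2 * r) : r⁻¹ ≤ growthRate S := by
  have hone : 0 < 1 - r := sub_pos.mpr hr₁
  rcases le_or_gt h₂ (2 * h₁) with hle | hgt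
  · refine hN.inv_le_growthRate_of_le_two_mul hb hS hp₂ hp₃ hlt hle hr hr₁ (sub_pos.mp ?_)
    calc 0 < (r ^ 2 + 2 * r - 1) * (r ^ 3 + (1 - r)) / (1 - r) ^ 2 := by
          have := sub_pos.mpr hr₂
          positivity
      _ = _ := by field_simp; ring
  · refine hN.inv_le_growthRate_of_two_mul_lt hb hS hp₂ hgt hr hr₁ (sub_pos.mp ?_)
    -- `0.414 < √2 - 1`, the positive root of `r ^ 2 + 2 * r = 1`.
    have hlo : 0.414 < r := by nlinarith
    have hnum : 0 < r ^ 5 - r ^ 3 - r ^ 2 + 3 * r - 1 := by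
      have hpow : 0.414 ^ 5 ≤ r ^ 5 := by gcongr
      nlinarith [mul_pos (sub_pos.mpr hlo) hone, mul_pos (mul_pos (sub_pos.mpr hlo) hone) hr]
    calc 0 < (r ^ 5 - r ^ 3 - r ^ 2 + 3 * r - 1) / (1 - r) ^ 2 := by positivity
      _ = _ := by field_simp; ring

end NormalizedPair

section DigitLengthSum

variable {k : ℕ} {r : ℝ}

/-- The sum of `r ^ ℓ` over the lengths `ℓ` of the words `a ^ i * t`, where `i` runs through the
balanced digits modulo `2 * k + 1`. It equals `1` at the reciprocal of the optimal growth rate. -/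
noncomputable def digitLengthSum (k : ℕ) (r : ℝ) : ℝ :=
  ∑ i ∈ Finset.Icc (-k : ℤ) k, r ^ (i.natAbs + 1)

theorem sum_Icc_neg {M : Type*} [AddCommMonoid M] (f : ℤ → M) (k : ℕ) :
    ∑ i ∈ Finset.Icc (-k : ℤ) k, f i =
      f 0 + ∑ i ∈ Finset.range k, (f (i + 1) + f (-(i + 1))) := by
  induction k with
  | zero => simp
  | succ k ih =>
    have hIcc : Finset.Icc (-(k + 1 : ℕ) : ℤ) (k + 1 : ℕ) =
        insert (k + 1 : ℤ) (insert (-(k + 1) : ℤ) (Finset.Icc (-k : ℤ) k)) := by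
      ext i
      simp only [Finset.mem_Icc, Finset.mem_insert]
      omega
    have hnotMem : (k + 1 : ℤ) ∉ insert (-(k + 1) : ℤ) (Finset.Icc (-k : ℤ) k) := by
      rw [Finset.mem_insert, Finset.mem_Icc]
      omega
    rw [hIcc, Finset.sum_insert hnotMem, Finset.sum_insert (by simp), ih, Finset.sum_range_succ]
    abel

theorem digitLengthSum_eq (k : ℕ) (r : ℝ) :
    digitLengthSum k r = r + 2 * ∑ i ∈ Finset.range k, r ^ (i + 2) := by
  rw [digitLengthSum, sum_Icc_neg, Finset.mul_sum]
  simp only [Int.natAbs_neg, Int.natAbs_zero, zero_add, pow_one, ← two_mul]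
  rfl

theorem sq_add_two_mul_of_digitLengthSum_eq_one (h : digitLengthSum k r = 1) :
    r ^ 2 + 2 * r = 1 + 2 * r ^ (k + 2) := by
  have hgeom := mul_neg_geom_sum r k
  have hshift : ∑ i ∈ Finset.range k, r ^ (i + 2) = (∑ i ∈ Finset.range k, r ^ i) * r ^ 2 := by
    simp only [pow_add, Finset.sum_mul]
  rw [digitLengthSum_eq, hshift] at h
  linear_combination (1 - r) * h - 2 * r ^ 2 * hgeom

theorem lt_one_of_digitLengthSum_eq_one (hk : 1 ≤ k) (hr : 0 < r) (h : digitLengthSum k r = 1) :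
    r < 1 := by
  have hpos : 0 < ∑ i ∈ Finset.range k, r ^ (i + 2) :=
    Finset.sum_pos (fun i _ ↦ by positivity) (Finset.nonempty_range_iff.mpr (by omega))
  rw [digitLengthSum_eq] at h
  linarith

theorem strictMonoOn_digitLengthSum (k : ℕ) : StrictMonoOn (digitLengthSum k) (Set.Ici 0) := by
  intro r hr s _ hrs
  rw [Set.mem_Ici] at hr
  exact Finset.sum_lt_sum_of_nonempty (by simp) fun i _ ↦ by gcongr

theorem exists_digitLengthSum_eq_one (k : ℕ) : ∃ r, 0 < r ∧ r ≤ 1 ∧ digitLengthSum k r = 1 := by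
  have hcont : Continuous (digitLengthSum k) :=
    continuous_finsetSum _ fun i _ ↦ continuous_pow (i.natAbs + 1)
  have hzero : digitLengthSum k 0 = 0 := by simp [digitLengthSum]
  have hone : 1 ≤ digitLengthSum k 1 := by simp [digitLengthSum_eq]
  obtain ⟨r, ⟨hr, hr₁⟩, hsum⟩ := intermediate_value_Icc zero_le_one hcont.continuousOn
    ⟨hzero.trans_le zero_le_one, hone⟩
  exact ⟨r, hr.lt_of_ne (by rintro rfl; simp [hzero] at hsum), hr₁, hsum⟩

theorem eval_growthPoly (k : ℕ) {z : ℝ} (hz : z ≠ 0) :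
    (growthPoly k).eval z = z ^ (k + 1) * (1 - digitLengthSum k z⁻¹) := by
  have hsum : ∑ i ∈ Finset.range k, 2 * z ^ i =
      z ^ (k + 1) * (2 * ∑ i ∈ Finset.range k, z⁻¹ ^ (i + 2)) := by
    rw [← Finset.sum_range_reflect, Finset.mul_sum, Finset.mul_sum]
    refine Finset.sum_congr rfl fun i hi ↦ ?_
    have hsplit : k + 1 = (k - 1 - i) + (i + 2) := by
      have := Finset.mem_range.mp hi
      omega
    rw [hsplit, pow_add z, inv_pow]
    field_simp
  rw [digitLengthSum_eq, mul_sub, mul_add, ← hsum, pow_succ, mul_inv_cancel_right₀ hz]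
  simp only [growthPoly, eval_sub, eval_pow, eval_X, eval_finsetSum, eval_mul, eval_C]
  ring

theorem isRoot_growthPoly_iff {z : ℝ} (hz : z ≠ 0) :
    (growthPoly k).IsRoot z ↔ digitLengthSum k z⁻¹ = 1 := by
  rw [IsRoot.def, eval_growthPoly k hz, mul_eq_zero, or_iff_right (pow_ne_zero _ hz), sub_eq_zero,
    eq_comm]

theorem isUniquePositiveRoot_inv_of_digitLengthSum_eq_one (hr : 0 < r)
    (h : digitLengthSum k r = 1) : IsUniquePositiveRoot (growthPoly k) r⁻¹ := by
  refine ⟨inv_pos.mpr hr, (isRoot_growthPoly_iff (inv_ne_zero hr.ne')).mpr (by rwa [inv_inv]),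
    fun s hs hroot ↦ inv_eq_iff_eq_inv.mp ?_⟩
  exact (strictMonoOn_digitLengthSum k).injOn (inv_nonneg.mpr hs.le) hr.le
    (((isRoot_growthPoly_iff hs.ne').mp hroot).trans h.symm)

theorem one_le_sum_Icc_pow_natAbs_two_mul_sub_one (hk : 1 ≤ k) (hr : 0 < r)
    (h : digitLengthSum k r = 1) : 1 ≤ ∑ i ∈ Finset.Icc (-k : ℤ) k, r ^ (2 * i - 1).natAbs := by
  have hr₁ := lt_one_of_digitLengthSum_eq_one hk hr h
  have hone : 0 < 1 - r ^ 2 := by nlinarith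
  have hsum : ∑ i ∈ Finset.Icc (-k : ℤ) k, r ^ (2 * i - 1).natAbs =
      r + (r + r ^ 3) * ∑ i ∈ Finset.range k, (r ^ 2) ^ i := by
    rw [sum_Icc_neg, Finset.mul_sum]
    congr 1
    · simp
    refine Finset.sum_congr rfl fun i _ ↦ ?_
    rw [show (2 * ((i : ℤ) + 1) - 1).natAbs = 2 * i + 1 by omega,
      show (2 * (-((i : ℤ) + 1)) - 1).natAbs = 2 * i + 3 by omega]
    ring
  have hgeom := mul_neg_geom_sum (r ^ 2) k
  have htail : (r + r ^ 3) * (r ^ 2) ^ k ≤ 2 * r ^ (k + 2) :=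
    calc (r + r ^ 3) * (r ^ 2) ^ k = (1 + r ^ 2) * r ^ (2 * k + 1) := by ring
      _ ≤ 2 * r ^ (k + 2) := mul_le_mul (by linarith)
        (pow_le_pow_of_le_one hr.le hr₁.le (by omega)) (by positivity) zero_le_two
  rw [hsum]
  refine le_of_mul_le_mul_left ?_ hone
  linear_combination
    htail - (r + r ^ 3) * hgeom - sq_add_two_mul_of_digitLengthSum_eq_one h

end DigitLengthSum

theorem eq_of_dvd_sub_of_mem_Icc {k : ℕ} {i j : ℤ} (hi : i ∈ Finset.Icc (-k : ℤ) k)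
    (hj : j ∈ Finset.Icc (-k : ℤ) k) (h : ((2 * k + 1 : ℕ) : ℤ) ∣ i - j) : i = j := by
  rw [Finset.mem_Icc] at hi hj
  exact sub_eq_zero.mp (Int.eq_zero_of_abs_lt_dvd h (abs_lt.mpr ⟨by omega, by omega⟩))

namespace NormalizedPair

variable {G K : Type*} [Group G] [Field K] {φ : G →* Equiv.Perm K} {p : ℕ} {O : Subring K} {π : K}
  {S : Set G} {x y : G} {h₁ h₂ : ℤ} {r : ℝ}

theorem inv_le_growthRate_of_odd {k : ℕ} (hN : NormalizedPair φ π S x y h₁ h₂)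
    (hb : IsDigitBase (2 * k + 1) O π) (hS : S.Finite) (hh : h₂ = 0 ∨ h₁ ≤ h₂) (hk : 1 ≤ k)
    (hr : 0 < r) (hsum : digitLengthSum k r = 1) : r⁻¹ ≤ growthRate S := by
  have hdigits (i : ℤ) (hi : i ∈ Finset.Icc (-k : ℤ) k) (j : ℤ) (hj : j ∈ Finset.Icc (-k : ℤ) k) :=
    eq_of_dvd_sub_of_mem_Icc hi hj
  rcases hh with rfl | hle
  · exact hN.inv_le_growthRate_of_digits hb hS hdigits hr hsum.ge
  rcases hle.eq_or_lt with rfl | hlt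
  · exact hN.inv_le_growthRate_of_digits_of_eq hb hS hdigits hr
      (one_le_sum_Icc_pow_natAbs_two_mul_sub_one hk hr hsum)
  have hquad := sq_add_two_mul_of_digitLengthSum_eq_one hsum
  rcases hk.eq_or_lt with rfl | hk₁
  · have hroot : r + 2 * r ^ 2 = 1 := by simpa [digitLengthSum_eq] using hsum
    have hr₂ : 2⁻¹ ≤ r := by nlinarith
    exact (inv_le_of_inv_le₀ two_pos hr₂).trans (hN.two_le_growthRate hb hS (hN.pos.trans hlt))
  · have not_dvd {m : ℤ} (hm : 0 < m) (hm₅ : m < 5) : ¬ ((2 * k + 1 : ℕ) : ℤ) ∣ m := fun h ↦ by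
      have := Int.le_of_dvd hm h
      omega
    have := pow_pos hr (k + 2)
    exact hN.inv_le_growthRate_of_lt hb hS (not_dvd two_pos (by norm_num))
      (not_dvd three_pos (by norm_num)) hlt hr (lt_one_of_digitLengthSum_eq_one hk hr hsum)
      (by linarith)

end NormalizedPair

end GroupGrowth

/-! ### Minimal growth rates -/

namespace GroupGrowth

variable {G K : Type*} [Group G] [Field K] {φ : G →* Equiv.Perm K} {O : Subring K} {π : K}
  {a t : G} {S : Set G} {r : ℝ}

theorem realizesMinimalGrowthRate_of_forall_le (hS : IsFiniteGeneratingSet S) {z : ℝ}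
    (hle : growthRate S ≤ z) (hge : ∀ T : Set G, IsFiniteGeneratingSet T → z ≤ growthRate T) :
    RealizesMinimalGrowthRate S ∧ minimalGrowthRate G = z := by
  have hz : growthRate S = z := le_antisymm hle (hge S hS)
  have hmin : minimalGrowthRate G = z :=
    IsLeast.csInf_eq ⟨⟨S, hS, hz⟩, fun _ ⟨T, hT, hTz⟩ ↦ hTz ▸ hge T hT⟩
  exact ⟨⟨hS, hz.trans hmin.symm⟩, hmin⟩

theorem exists_balanced_digit (k : ℕ) (c : ℤ) : ∃ i ∈ Finset.Icc (-k : ℤ) k, ∃ q : ℤ,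
    c = i + (2 * k + 1 : ℕ) * q ∧ i.natAbs + q.natAbs ≤ c.natAbs := by
  obtain ⟨i, q, hlo, hhi, hc⟩ : ∃ i q : ℤ, -k ≤ i ∧ i ≤ k ∧ c = i + (2 * (k * q) + q) := by
    have hp : (0 : ℤ) < 2 * k + 1 := by omega
    have hnonneg := Int.emod_nonneg (c + k) hp.ne'
    have hlt := Int.emod_lt_of_pos (c + k) hp
    refine ⟨(c + k) % (2 * k + 1) - k, (c + k) / (2 * k + 1), by omega, by omega, ?_⟩
    linear_combination -Int.emod_add_mul_ediv (c + k) (2 * k + 1)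
  refine ⟨i, Finset.mem_Icc.mpr ⟨hlo, hhi⟩, q, by push_cast; linarith, ?_⟩
  rcases lt_trichotomy q 0 with hq | rfl | hq
  · have : (k : ℤ) * q ≤ -k := by nlinarith
    omega
  · omega
  · have : (k : ℤ) ≤ k * q := by nlinarith
    omega

namespace IsAffineModel

theorem realizes_of_odd {k : ℕ} (hM : IsAffineModel (2 * k + 1) O π φ a t)
    (hcomm : ∀ i : ℕ, Commute (t ^ i * a * (t ^ i)⁻¹) a)
    (hcarry : ∀ q : ℤ, ∃ q' : ℤ, q'.natAbs ≤ q.natAbs ∧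
      a ^ ((2 * k + 1 : ℕ) * q) * t = t * a ^ q')
    (hr : 0 < r) (hr₁ : r ≤ 1) (hsum : digitLengthSum k r = 1) :
    RealizesMinimalGrowthRate ({a, t} : Set G) ∧ minimalGrowthRate G = r⁻¹ := by
  have hk : 1 ≤ k := Nat.pos_of_ne_zero fun h ↦ hM.ne_one (by simp [h])
  refine realizesMinimalGrowthRate_of_forall_le hM.isFiniteGeneratingSet ?_ fun T hT ↦ ?_
  · refine growthRate_le_of_digits hcomm (fun c ↦ ?_) ((one_le_inv₀ hr).mpr hr₁)
      (by rw [inv_inv]; exact hsum.le)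
    obtain ⟨i, hi, q, hc, hlen⟩ := exists_balanced_digit k c
    obtain ⟨q', hq', hred⟩ := hcarry q
    exact ⟨i, hi, q', by rw [hc, zpow_add, mul_assoc, hred, mul_assoc], by omega⟩
  · obtain ⟨_, _, _, _, _, hN, hh⟩ := hM.exists_normalizedPair hT.2
    exact hN.inv_le_growthRate_of_odd hM.toIsDigitBase hT.1 hh hk hr hsum

theorem inv_le_growthRate_of_translation {p : ℕ} (hM : IsAffineModel p O π φ a t)
    (hS : IsFiniteGeneratingSet S) (hr : 2⁻¹ ≤ r)
    (htranslation : ∀ (ψ : G →* Equiv.Perm K) (x y : G) (h : ℤ),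
      NormalizedPair ψ π S x y h 0 → r⁻¹ ≤ growthRate S) : r⁻¹ ≤ growthRate S := by
  obtain ⟨ψ, x, y, h₁, h₂, hN, rfl | hle⟩ := hM.exists_normalizedPair hS.2
  · exact htranslation ψ x y h₁ hN
  · exact (inv_le_of_inv_le₀ two_pos hr).trans
      (hN.two_le_growthRate hM.toIsDigitBase hS.1 (hN.pos.trans_le hle))

end IsAffineModel

end GroupGrowth

open GroupGrowth

namespace Lamplighter

section Generators

variable {p : ℕ}

theorem t_zpow (i : ℤ) : t p ^ i = SemidirectProduct.inr (Multiplicative.ofAdd i) := by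
  rw [t, ← map_zpow, ← ofAdd_zsmul, smul_eq_mul, mul_one]

theorem a_zpow (n : ℤ) :
    a p ^ n = SemidirectProduct.inl (Multiplicative.ofAdd (Finsupp.single 0 (n : ZMod p))) := by
  rw [a, ← map_zpow, ← ofAdd_zsmul, Finsupp.smul_single, zsmul_one]

theorem t_zpow_mul_a_zpow_mul_inv (i n : ℤ) :
    t p ^ i * a p ^ n * (t p ^ i)⁻¹ =
      SemidirectProduct.inl (Multiplicative.ofAdd (Finsupp.single i (n : ZMod p))) := by
  rw [t_zpow, a_zpow, ← map_inv, ← SemidirectProduct.inl_aut]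
  congr 1
  refine Multiplicative.toAdd.injective ?_
  change Finsupp.domCongr (Equiv.addRight i) (Finsupp.single 0 (n : ZMod p)) = _
  simp [Finsupp.domCongr]

theorem closure_a_t : Subgroup.closure {a p, t p} = ⊤ := by
  have ha : a p ∈ Subgroup.closure {a p, t p} := Subgroup.subset_closure (by simp)
  have ht : t p ∈ Subgroup.closure {a p, t p} := Subgroup.subset_closure (by simp)
  have hinl (f : ℤ →₀ ZMod p) :
      SemidirectProduct.inl (Multiplicative.ofAdd f) ∈ Subgroup.closure {a p, t p} := by
    induction f using Finsupp.induction_linear with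
    | zero => simp
    | add f f' hf hf' =>
      rw [ofAdd_add, map_mul]
      exact mul_mem hf hf'
    | single i c =>
      obtain ⟨n, rfl⟩ := ZMod.intCast_surjective c
      rw [← t_zpow_mul_a_zpow_mul_inv]
      exact mul_mem (mul_mem (zpow_mem ht i) (zpow_mem ha n)) (inv_mem (zpow_mem ht i))
  have hinr (m : Multiplicative ℤ) :
      SemidirectProduct.inr m ∈ Subgroup.closure {a p, t p} := by
    rw [← ofAdd_toAdd m, ← t_zpow]
    exact zpow_mem ht _
  refine eq_top_iff.mpr fun g _ ↦ ?_
  rw [← SemidirectProduct.inl_left_mul_inr_right g]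
  exact mul_mem (hinl g.left.toAdd) (hinr g.right)

theorem commute_conj (i : ℕ) : Commute (t p ^ i * a p * (t p ^ i)⁻¹) (a p) := by
  have hconj := t_zpow_mul_a_zpow_mul_inv (p := p) i 1
  rw [zpow_natCast, zpow_one] at hconj
  rw [hconj, a]
  exact (Commute.all _ _).map SemidirectProduct.inl

theorem a_zpow_natCast_mul (q : ℤ) : a p ^ (p * q) = 1 := by
  simp [a_zpow]

end Generators

variable (p : ℕ) [Fact p.Prime]

/-- The Laurent polynomial of a configuration, as a Laurent series. -/
noncomputable def toLaurent : (ℤ →₀ ZMod p) →+ LaurentSeries (ZMod p) :=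
  Finsupp.liftAddHom fun i ↦ HahnSeries.single.addMonoidHom i

theorem toLaurent_single (i : ℤ) (c : ZMod p) :
    toLaurent p (Finsupp.single i c) = HahnSeries.single i c :=
  Finsupp.liftAddHom_apply_single _ _ _

theorem toLaurent_shift (m : ℤ) (f : ℤ →₀ ZMod p) :
    toLaurent p (Finsupp.domCongr (Equiv.addRight m) f) =
      HahnSeries.single 1 1 ^ m * toLaurent p f := by
  induction f using Finsupp.induction_linear with
  | zero => simp
  | add f f' hf hf' => rw [map_add, map_add, hf, hf', map_add, mul_add]
  | single i c =>
    rw [← RatFunc.single_zpow, toLaurent_single, HahnSeries.single_mul_single, one_mul, add_comm]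
    simp [Finsupp.domCongr, toLaurent_single]

theorem isDigitBase : IsDigitBase p (HahnSeries.ofPowerSeries ℤ (ZMod p)).range
    (HahnSeries.single 1 1 : LaurentSeries (ZMod p)) where
  mem := ⟨PowerSeries.X, HahnSeries.ofPowerSeries_X⟩
  ne_zero := HahnSeries.single_ne_zero one_ne_zero
  ne_one := (Fact.out : p.Prime).ne_one
  dvd := by
    rintro c _ ⟨w, rfl⟩ h
    rw [← HahnSeries.ofPowerSeries_X, ← map_mul,
      ← map_intCast (HahnSeries.ofPowerSeries ℤ (ZMod p))] at h
    have hcoeff := congrArg PowerSeries.constantCoeff (HahnSeries.ofPowerSeries_injective h)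
    rw [map_mul, PowerSeries.constantCoeff_X, zero_mul, map_intCast] at hcoeff
    exact (ZMod.intCast_zmod_eq_zero_iff_dvd c p).mp hcoeff

/-- The action of the lamplighter group on Laurent series: configurations act by translations and
`ℤ` by multiplication with the powers of the variable. -/
noncomputable def affineAction : Lamplighter p →* Equiv.Perm (LaurentSeries (ZMod p)) :=
  SemidirectProduct.lift
    { toFun := fun f ↦ Equiv.addRight (toLaurent p f.toAdd)
      map_one' := by ext1 u; simp
      map_mul' := fun f g ↦ by ext1 u; simp [add_comm, add_left_comm] }
    ((MulAction.toPermHom (LaurentSeries (ZMod p))ˣ _).comp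
      (zpowersHom _ (Units.mk0 _ (isDigitBase p).ne_zero)))
    fun m ↦ MonoidHom.ext fun f ↦ by
      change Equiv.addRight (toLaurent p (Finsupp.domCongr (Equiv.addRight m.toAdd) f.toAdd)) = _
      rw [toLaurent_shift]
      refine eq_mul_inv_of_mul_eq (Equiv.ext fun u ↦ ?_)
      simp [Units.smul_def]

theorem isAffineModel : IsAffineModel p (HahnSeries.ofPowerSeries ℤ (ZMod p)).range
    (HahnSeries.single 1 1) (affineAction p) (a p) (t p) where
  toIsDigitBase := isDigitBase p
  closure_eq_top := closure_a_t
  a_acts u := by simp [affineAction, a, toLaurent_single]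
  t_acts u := by simp [affineAction, t, Units.smul_def]

end Lamplighter

namespace BS

section Relation

variable {p : ℕ}

theorem closure_a_t : Subgroup.closure {a p, t p} = ⊤ := by
  rw [← PresentedGroup.closure_range_of (bsRelators p)]
  congr 1
  ext g
  simp [a, t, eq_comm]

theorem t_mul_a_mul_inv : t p * a p * (t p)⁻¹ = a p ^ p := by
  have hrel := PresentedGroup.one_of_mem (rels := bsRelators p) (Set.mem_singleton _)
  rwa [map_mul, map_mul, map_mul, map_inv, map_inv, map_pow, mul_inv_eq_one] at hrel

theorem a_zpow_mul_t (q : ℤ) : a p ^ (p * q) * t p = t p * a p ^ q := by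
  rw [zpow_mul, zpow_natCast, ← t_mul_a_mul_inv, conj_zpow, inv_mul_cancel_right]

theorem t_pow_mul_a_mul_inv (i : ℕ) : t p ^ i * a p * (t p ^ i)⁻¹ = a p ^ p ^ i := by
  induction i with
  | zero => simp
  | succ i ih =>
    calc t p ^ (i + 1) * a p * (t p ^ (i + 1))⁻¹
        = t p * (t p ^ i * a p * (t p ^ i)⁻¹) * (t p)⁻¹ := by rw [pow_succ']; group
      _ = a p ^ p ^ (i + 1) := by rw [ih, ← conj_pow, t_mul_a_mul_inv, ← pow_mul, pow_succ']

theorem commute_conj (i : ℕ) : Commute (t p ^ i * a p * (t p ^ i)⁻¹) (a p) := by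
  rw [t_pow_mul_a_mul_inv]
  exact Commute.pow_self _ _

end Relation

variable (p : ℕ) [Fact p.Prime]

theorem isDigitBase : IsDigitBase p (PadicInt.subring p) (p : ℚ_[p]) where
  mem := natCast_mem _ p
  ne_zero := Nat.cast_ne_zero.mpr (Fact.out : p.Prime).ne_zero
  ne_one := (Fact.out : p.Prime).ne_one
  dvd c w hw h := by
    rw [← Padic.norm_intCast_lt_one_iff, h, norm_mul]
    exact (mul_le_of_le_one_right (norm_nonneg _) hw).trans_lt Padic.norm_p_lt_one

theorem two_notMem_adicBall :
    (2 : ℚ_[2]) ∉ adicBall (PadicInt.subring 2) ((2 : ℕ) : ℚ_[2]) 2 0 := by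
  rintro ⟨w, hw, h⟩
  refine (isDigitBase 2).not_dvd_one ((isDigitBase 2).dvd 1 w hw ?_)
  push_cast at h ⊢
  linear_combination h / 2

/-- The affine action of `BS(1, p)` on the `p`-adic numbers. -/
noncomputable def affineAction : BS p →* Equiv.Perm ℚ_[p] :=
  PresentedGroup.toGroup
    (f := ![Equiv.addRight 1, Equiv.mulLeft₀ (p : ℚ_[p]) (isDigitBase p).ne_zero]) fun r hr ↦ by
      rw [Set.mem_singleton_iff.mp hr]
      simp only [map_mul, map_inv, map_pow, FreeGroup.lift_apply_of, Matrix.cons_val_zero,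
        Matrix.cons_val_one]
      rw [mul_inv_eq_one, mul_inv_eq_iff_eq_mul]
      ext1 u
      simp [mul_add]

theorem isAffineModel :
    IsAffineModel p (PadicInt.subring p) (p : ℚ_[p]) (affineAction p) (a p) (t p) where
  toIsDigitBase := isDigitBase p
  closure_eq_top := closure_a_t
  a_acts u := by simp [affineAction, a]
  t_acts u := by simp [affineAction, t]

end BS

theorem Lamplighter.realizes_of_odd {k : ℕ} [Fact (2 * k + 1).Prime] {r : ℝ} (hr : 0 < r)
    (hr₁ : r ≤ 1) (hsum : digitLengthSum k r = 1) :
    RealizesMinimalGrowthRate {Lamplighter.a (2 * k + 1), Lamplighter.t (2 * k + 1)} ∧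
      minimalGrowthRate (Lamplighter (2 * k + 1)) = r⁻¹ :=
  (Lamplighter.isAffineModel _).realizes_of_odd Lamplighter.commute_conj
    (fun q ↦ ⟨0, by simp, by rw [Lamplighter.a_zpow_natCast_mul, one_mul, zpow_zero, mul_one]⟩)
    hr hr₁ hsum

theorem BS.realizes_of_odd {k : ℕ} [Fact (2 * k + 1).Prime] {r : ℝ} (hr : 0 < r) (hr₁ : r ≤ 1)
    (hsum : digitLengthSum k r = 1) :
    RealizesMinimalGrowthRate {BS.a (2 * k + 1), BS.t (2 * k + 1)} ∧
      minimalGrowthRate (BS (2 * k + 1)) = r⁻¹ :=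
  (BS.isAffineModel _).realizes_of_odd BS.commute_conj
    (fun q ↦ ⟨q, le_rfl, BS.a_zpow_mul_t q⟩) hr hr₁ hsum

theorem Lamplighter.realizes_two {r : ℝ} (hr : 2⁻¹ ≤ r) (hr₁ : r ≤ 1) (hroot : r + r ^ 2 = 1) :
    RealizesMinimalGrowthRate {Lamplighter.a 2, Lamplighter.t 2} ∧
      minimalGrowthRate (Lamplighter 2) = r⁻¹ := by
  have hpos : 0 < r := (inv_pos.mpr two_pos).trans_le hr
  have hM := Lamplighter.isAffineModel 2
  have hsum : ∑ i ∈ {0, 1}, r ^ (Int.natAbs i + 1) = 1 := by simp [hroot]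
  refine realizesMinimalGrowthRate_of_forall_le hM.isFiniteGeneratingSet ?_ fun T hT ↦ ?_
  · refine growthRate_le_of_digits Lamplighter.commute_conj (fun c ↦ ?_)
      ((one_le_inv₀ hpos).mpr hr₁) (by rw [inv_inv]; exact hsum.le)
    refine ⟨c % 2, by simpa using Int.emod_two_eq_zero_or_one c, 0, ?_, by omega⟩
    have hred : Lamplighter.a 2 ^ c = Lamplighter.a 2 ^ (c % 2) :=
      calc Lamplighter.a 2 ^ c = Lamplighter.a 2 ^ (c % 2 + (2 : ℕ) * (c / 2)) := by
            rw [Nat.cast_two, Int.emod_add_mul_ediv]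
        _ = _ := by rw [zpow_add, Lamplighter.a_zpow_natCast_mul, mul_one]
    rw [hred, zpow_zero, mul_one]
  · exact hM.inv_le_growthRate_of_translation hT hr fun _ _ _ _ hN ↦
      hN.inv_le_growthRate_of_digits hM.toIsDigitBase hT.1 (by simp) hpos
        hsum.ge

theorem BS.realizes_two {r : ℝ} (hr : 2⁻¹ ≤ r) (hr₁ : r ≤ 1) (hroot : r + 2 * r ^ 3 = 1) :
    RealizesMinimalGrowthRate {BS.a 2, BS.t 2} ∧ minimalGrowthRate (BS 2) = r⁻¹ := by
  have hpos : 0 < r := (inv_pos.mpr two_pos).trans_le hr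
  have hM := BS.isAffineModel 2
  refine realizesMinimalGrowthRate_of_forall_le hM.isFiniteGeneratingSet ?_ fun T hT ↦ ?_
  · exact growthRate_le_of_nonadjacent BS.a_zpow_mul_t BS.commute_conj
      ((one_le_inv₀ hpos).mpr hr₁) (by rw [inv_inv]; exact hroot.le)
  · exact hM.inv_le_growthRate_of_translation hT hr fun _ _ _ _ hN ↦
      hN.inv_le_growthRate_of_nonadjacent hM.toIsDigitBase hT.1 BS.two_notMem_adicBall hpos
        hroot.ge

theorem exists_isUniquePositiveRoot_cubic :
    ∃ β : ℝ, IsUniquePositiveRoot (X ^ 3 - X ^ 2 - 2) β ∧ |β - 1.69562| < 0.000005 := by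
  have heval (z : ℝ) : (X ^ 3 - X ^ 2 - 2 : ℝ[X]).eval z = z ^ 3 - z ^ 2 - 2 := by simp
  obtain ⟨β, ⟨hlo, hhi⟩, hβ⟩ : (0 : ℝ) ∈ (fun z : ℝ ↦ z ^ 3 - z ^ 2 - 2) ''
      Set.Icc 1.695616 1.695624 :=
    intermediate_value_Icc (by norm_num) (by fun_prop) ⟨by norm_num, by norm_num⟩
  dsimp only at hβ
  refine ⟨β, ⟨by linarith, by rw [IsRoot.def, heval, hβ], fun s hs hroot ↦ ?_⟩,
    abs_lt.mpr ⟨by linarith, by linarith⟩⟩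
  rw [IsRoot.def, heval] at hroot
  have hs₁ : 1 < s := by
    by_contra!
    nlinarith [sq_nonneg s]
  have hfactor : (s - β) * (s ^ 2 + s * β + β ^ 2 - s - β) = 0 := by
    linear_combination hroot - hβ
  exact sub_eq_zero.mp ((mul_eq_zero.mp hfactor).resolve_right (by nlinarith))

theorem inv_goldenRatio_add_sq : Real.goldenRatio⁻¹ + Real.goldenRatio⁻¹ ^ 2 = 1 := by
  rw [Real.inv_goldenRatio, neg_sq, Real.goldenConj_sq, neg_add_cancel_left]

theorem inv_add_two_mul_inv_pow_three {z : ℝ} (hz : IsUniquePositiveRoot (X ^ 3 - X ^ 2 - 2) z) :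
    z⁻¹ + 2 * z⁻¹ ^ 3 = 1 := by
  obtain ⟨hpos, hroot, -⟩ := hz
  simp only [IsRoot.def, eval_sub, eval_pow, eval_X, eval_ofNat] at hroot
  field_simp
  linear_combination -hroot

theorem theorem1 :
    (∀ p : ℕ, p.Prime →
      GroupGrowth.RealizesMinimalGrowthRate {Lamplighter.a p, Lamplighter.t p} ∧
      GroupGrowth.RealizesMinimalGrowthRate {BS.a p, BS.t p}) ∧
    (∀ k : ℕ, (2 * k + 1).Prime → ∃ ω : ℝ,
      IsUniquePositiveRoot (growthPoly k) ω ∧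
      GroupGrowth.minimalGrowthRate (Lamplighter (2 * k + 1)) = ω ∧
      GroupGrowth.minimalGrowthRate (BS (2 * k + 1)) = ω) ∧
    ∃ β : ℝ,
      IsUniquePositiveRoot (X ^ 3 - X ^ 2 - 2) β ∧
      |β - 1.69562| < 0.000005 ∧
      GroupGrowth.minimalGrowthRate (Lamplighter 2) = (1 + Real.sqrt 5) / 2 ∧
      GroupGrowth.minimalGrowthRate (BS 2) = β ∧
      (1 + Real.sqrt 5) / 2 < β := by
  have hL := Lamplighter.realizes_two (inv_anti₀ Real.goldenRatio_pos Real.goldenRatio_lt_two.le)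
    (inv_le_one_of_one_le₀ Real.one_lt_goldenRatio.le) inv_goldenRatio_add_sq
  obtain ⟨β, hβ, hβ'⟩ := exists_isUniquePositiveRoot_cubic
  obtain ⟨hlo, hhi⟩ := abs_lt.mp hβ'
  have hBS := BS.realizes_two (inv_anti₀ hβ.1 (by linarith)) (inv_le_one_of_one_le₀ (by linarith))
    (inv_add_two_mul_inv_pow_three hβ)
  rw [inv_inv] at hL hBS
  refine ⟨fun p hp ↦ ?_, fun k hk ↦ ?_, β, hβ, hβ', hL.2, hBS.2, ?_⟩
  · rcases hp.eq_two_or_odd' with rfl | ⟨k, rfl⟩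
    · exact ⟨hL.1, hBS.1⟩
    · have := Fact.mk hp
      obtain ⟨r, hr, hr₁, hsum⟩ := exists_digitLengthSum_eq_one k
      exact ⟨(Lamplighter.realizes_of_odd hr hr₁ hsum).1, (BS.realizes_of_odd hr hr₁ hsum).1⟩
  · have := Fact.mk hk
    obtain ⟨r, hr, hr₁, hsum⟩ := exists_digitLengthSum_eq_one k
    exact ⟨r⁻¹, isUniquePositiveRoot_inv_of_digitLengthSum_eq_one hr hsum,
      (Lamplighter.realizes_of_odd hr hr₁ hsum).2, (BS.realizes_of_odd hr hr₁ hsum).2⟩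
  · have : Real.sqrt 5 < 2.3 := (Real.sqrt_lt' (by norm_num)).mpr (by norm_num)
    linarith
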